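/- A seller offers two items to a single additive buyer whose values $x,y\in[0,1]$ for items 1 and 2 are independent with densities $f_1(x)=2(1-x)$ and $f_2(y)=2(1-y)$; write $f(x,y)=f_1(x)f_2(y)$ and $X=[0,1]^2$. A (direct) mechanism consists of an allocation function $\mathcal P:X\to[0,1]^2$ and a price function $\mathcal T:X\to\mathbb R$. It is incentive compatible (IC) if $v\cdot\mathcal P(v)-\mathcal T(v)\ge v\cdot\mathcal P(w)-\mathcal T(w)$ for all $v,w\in X$, and individually rational (IR) if $v\cdot\mathcal P(v)-\mathcal T(v)\ge 0$ for all $v\in X$; its revenue is $\int_X \mathcal T f$. It is optimal if it is IC and IR and its revenue is at least that of every IC and IR mechanism (all these revenues are integrals of integrable functions). Its menu is $\{(\mathcal P(v),\mathcal T(v)):v\in X\}$. Let $\mu$ be the transformed measure of $f$, $$\mu(S)=\int_{\partial X}\mathbb 1_S\, f(v)\,(v\cdot\hat n)\,dv-\int_X \mathbb 1_S\,(\nabla f(v)\cdot v+3f(v))\,dv+\mathbb 1_S(0,0),$$ where $\hat n$ is the outer unit normal. Let $s(t)=\frac{2-3t}{4-5t}$ for $t\le \frac23$, and for $p>0$ let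 $$Z_p=\{(x,y)\in X:\ x\le\tfrac23,\ y\le s(x),\ y\le\tfrac23,\ x\le s(y),\ x+y\le p\}.$$ There is exactly one $p^*>0$ with $\mu(Z_{p^*})=0$, and $|p^*-0.5535|<0.00005$. The minimum $c$ of $\{x:(x,p^*-x)\in Z_{p^*}\}$ exists, equals the minimum of $\{y:(p^*-y,y)\in Z_{p^*}\}$, and satisfies $s(c)=p^*-c$ and $0.0618<c<0.0619$. Put $$\mathcal A=\{(x,y):0\le x<c,\ s(x)\le y\le 1\},\qquad \mathcal B=\{(x,y):0\le y<c,\ s(y)\le x\le 1\},$$ $$\mathcal W=\{(x,y)\in[c,1]^2: x+y\ge p^*\},\qquad Z=X\setminus(\mathcal W\cup\mathcal A\cup\mathcal B).$$ Then $\mathcal A,\mathcal B,\mathcal W$ are pairwise disjoint subsets of $X$, the closure of $Z$ is $Z_{p^*}$, and $-s'(t)=\frac{2}{(4-5t)^2}$ for $0\le t<c$. The mechanism with the following outcomes for a buyer of type $(x,y)\in X$ is an optimal mechanism: * if $(x,y)\in Z$, the buyer receives no goods and is charged $0$; * if $(x,y)\in\mathcal A$, the buyer receives item 1 with probability $\frac{2}{(4-5x)^2}$,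 item 2 with probability 1, and is charged $\frac{2-3x}{4-5x}+\frac{2x}{(4-5x)^2}$; * if $(x,y)\in\mathcal B$, the buyer receives item 2 with probability $\frac{2}{(4-5y)^2}$, item 1 with probability 1, and is charged $\frac{2-3y}{4-5y}+\frac{2y}{(4-5y)^2}$; * if $(x,y)\in\mathcal W$, the buyer receives both items and is charged $p^*$. The menu of this optimal mechanism is infinite: the set of menu entries assigned to types in $\mathcal A$, the set of those assigned to types in $\mathcal B$, and the whole menu each have the cardinality of the continuum. -/

import Mathlib

open Set MeasureTheory

namespace TwoItem

/-- The type space `[0,1]²` of a buyer with values for two items. -/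
def typeSpace : Set (ℝ × ℝ) := Icc (0 : ℝ) 1 ×ˢ Icc (0 : ℝ) 1

/-- A direct mechanism on the type space: to a declared type it assigns the pair of probabilities
with which the buyer receives items 1 and 2, and a price. Only the values at points of the type
space matter. -/
structure Mechanism where
  alloc : ℝ × ℝ → ℝ × ℝ
  price : ℝ × ℝ → ℝ
  alloc_mem : ∀ v ∈ typeSpace, alloc v ∈ Icc (0 : ℝ) 1 ×ˢ Icc (0 : ℝ) 1

namespace Mechanism

/-- The net expected utility of an additive buyer of type `v` who declares the type `w`. -/
def utility (M : Mechanism) (v w : ℝ × ℝ) : ℝ :=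
  v.1 * (M.alloc w).1 + v.2 * (M.alloc w).2 - M.price w

/-- Incentive compatibility. -/
def IC (M : Mechanism) : Prop :=
  ∀ v ∈ typeSpace, ∀ w ∈ typeSpace, M.utility v w ≤ M.utility v v

/-- Individual rationality. -/
def IR (M : Mechanism) : Prop :=
  ∀ v ∈ typeSpace, 0 ≤ M.utility v v

/-- Expected revenue when the type has density `f` on the type space. -/
noncomputable def revenue (f : ℝ × ℝ → ℝ) (M : Mechanism) : ℝ :=
  ∫ v in typeSpace, M.price v * f v

/-- `M` is a revenue-optimal IC and IR mechanism for the type density `f`. The integrability clause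
guarantees that all the revenues compared (that of `M` included) are genuine expectations. No
measurability is imposed on the competing mechanisms. -/
def IsOptimal (f : ℝ × ℝ → ℝ) (M : Mechanism) : Prop :=
  M.IC ∧ M.IR ∧ ∀ N : Mechanism, N.IC → N.IR →
    IntegrableOn (fun v => N.price v * f v) typeSpace ∧ revenue f N ≤ revenue f M

/-- The menu entry (allocation probabilities and price) assigned to a type. -/
def outcome (M : Mechanism) (v : ℝ × ℝ) : (ℝ × ℝ) × ℝ := (M.alloc v, M.price v)

/-- The set of all menu entries of a mechanism. -/
def menu (M : Mechanism) : Set ((ℝ × ℝ) × ℝ) := M.outcome '' typeSpace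

end Mechanism

/-- The transformed (signed) measure of a density `f` on `[0,1]²`, evaluated at a set `A`:
`∫_{∂X} 1_A f (x·n) - ∫_X 1_A (∇f(x)·x + 3 f(x)) dx + 1_A(0,0)`. For the outer normal `n` one has
`x·n = 1` on the faces `x₁ = 1` and `x₂ = 1`, and `x·n = 0` on the faces `x₁ = 0` and `x₂ = 0`. -/
noncomputable def transformedMeasure (f : ℝ × ℝ → ℝ) (A : Set (ℝ × ℝ)) : ℝ :=
  (∫ y in Icc (0 : ℝ) 1, A.indicator f (1, y)) + (∫ x in Icc (0 : ℝ) 1, A.indicator f (x, 1))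
    - (∫ v in typeSpace, A.indicator (fun v => fderiv ℝ f v v + 3 * f v) v)
    + A.indicator (fun _ => (1 : ℝ)) (0, 0)

/-- The density `2(1-x)` on `[0,1]` of a single item. -/
noncomputable def itemDensity (x : ℝ) : ℝ := 2 * (1 - x)

/-- The joint density of two independent items. -/
noncomputable def jointDensity (v : ℝ × ℝ) : ℝ := itemDensity v.1 * itemDensity v.2

/-- The boundary function `s(x) = (2-3x)/(4-5x)`, used for `x ≤ 2/3` only. -/
noncomputable def bdry (x : ℝ) : ℝ := (2 - 3 * x) / (4 - 5 * x)

/-- The points of `[0,1]²` lying (weakly) below the curve `y = s(x)`, `x ≤ 2/3`, the curve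
`x = s(y)`, `y ≤ 2/3`, and the line `x + y = p`. -/
def below (p : ℝ) : Set (ℝ × ℝ) :=
  {v | v ∈ typeSpace ∧ (v.1 ≤ 2 / 3 ∧ v.2 ≤ bdry v.1) ∧ (v.2 ≤ 2 / 3 ∧ v.1 ≤ bdry v.2) ∧
    v.1 + v.2 ≤ p}

/-- The region `𝒜` for the critical point `(c, c)`. -/
def regionA (c : ℝ) : Set (ℝ × ℝ) := {v | v.1 ∈ Ico 0 c ∧ v.2 ∈ Icc (bdry v.1) 1}

/-- The region `ℬ` for the critical point `(c, c)`. -/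
def regionB (c : ℝ) : Set (ℝ × ℝ) := {v | v.2 ∈ Ico 0 c ∧ v.1 ∈ Icc (bdry v.2) 1}

/-- The region `𝒲` for the critical point `(c, c)` and the critical price `p`. -/
def regionW (p c : ℝ) : Set (ℝ × ℝ) := {v | v.1 ∈ Icc c 1 ∧ v.2 ∈ Icc c 1 ∧ p ≤ v.1 + v.2}

/-- The exclusion region `Z`. -/
def regionZ (p c : ℝ) : Set (ℝ × ℝ) := typeSpace \ (regionW p c ∪ regionA c ∪ regionB c)

end TwoItem

namespace TwoItem

open Filter Topology

/-! The proof is a direct duality argument. In an IC mechanism the allocation is a subgradient of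
the indirect utility `u(v)`, so the price is `v·∇u - u`. Integrating by parts along each axis turns
revenue into the integral of `u` against `massDensity`, which is `-(∇f·v + 3f)`. No boundary terms
appear, because `t(1-t)` vanishes at both ends (`IC.revenue_eq`). It remains to show that `D = u* -
u_N` has nonnegative integral against `massDensity`, where `u*` belongs to the proposed mechanism
and `u_N` to any competitor. This holds on each of the four regions separately.

On `Z` the density is negative, `u* = 0` and `u_N ≥ 0`. On a column of `𝒜` the density changes sign
once, from negative to positive, and its total is zero: this is what defines the curve `s`. There
`u*` has the largest possible slope 1 in `y`, so `D` increases and the integral is nonnegative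
(`column_nonneg_bdry`). The region `ℬ` is the mirror image.

On `𝒲` both slopes of `u*` equal 1, so `D` increases in each coordinate, and the total mass is zero
by the choice of `p` and `c`. What is needed is first-order dominance
(`integral_regionW_monotone_nonneg`). Subtract from `D` its maximum over the part of `𝒲` below both
curves. The positive part of the result vanishes below the curves, the negative part vanishes above
a point under them, and cutting into columns and rows handles each.

The pair `p, c` comes from the intermediate value theorem on a short interval. Uniqueness of `p`
holds because the mass below the line strictly decreases in `p`. -/

/-- Integration by parts for a function on `[0,1]` with a bounded subgradient `q` against a weight
vanishing at both endpoints. -/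
lemma integral_subgradient_mul {u q : ℝ → ℝ} (hq : ∀ t ∈ Icc (0 : ℝ) 1, q t ∈ Icc (0 : ℝ) 1)
    (h : ∀ s ∈ Icc (0 : ℝ) 1, ∀ t ∈ Icc (0 : ℝ) 1, u t + q t * (s - t) ≤ u s)
    {w w' : ℝ → ℝ} (hw : ∀ t, HasDerivAt w (w' t) t) (hw' : Continuous w') (w0 : w 0 = 0)
    (w1 : w 1 = 0) :
    ∫ t in Icc (0 : ℝ) 1, q t * w t = -∫ t in Icc (0 : ℝ) 1, u t * w' t := by
  have qmono : MonotoneOn q (Icc 0 1) := by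
    intro s hs t ht hst
    rcases hst.eq_or_lt with rfl | hlt
    · exact le_rfl
    · have h1 := h s hs t ht
      have h2 := h t ht s hs
      by_contra! hc
      nlinarith [mul_pos (sub_pos.2 hlt) (sub_pos.2 hc)]
  have ucont : ContinuousOn u (Icc 0 1) := by
    have : LipschitzOnWith 1 u (Icc 0 1) := by
      refine LipschitzOnWith.of_dist_le_mul fun s hs t ht => ?_
      rw [Real.dist_eq, Real.dist_eq, NNReal.coe_one, one_mul]
      have h1 := h s hs t ht
      have h2 := h t ht s hs
      have h3 := hq s hs
      have h4 := hq t ht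
      rcases abs_cases (s - t) with ⟨e, _⟩ | ⟨e, _⟩ <;> rw [e, abs_le] <;>
        constructor <;> nlinarith [h3.1, h3.2, h4.1, h4.2]
    exact this.continuousOn
  have wcont : Continuous w := continuous_iff_continuousAt.2 fun t => (hw t).continuousAt
  have qint : IntegrableOn q (Icc 0 1) := qmono.integrableOn_isCompact isCompact_Icc
  have i1 : IntegrableOn (fun t => q t * w t) (Icc 0 1) :=
    qint.mul_continuousOn wcont.continuousOn isCompact_Icc
  have i2 : IntegrableOn (fun t => u t * w' t) (Icc 0 1) :=
    (ucont.mul hw'.continuousOn).integrableOn_compact isCompact_Icc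
  -- The fundamental theorem tolerates a countable exceptional set. A monotone `q` has only
  -- countably many discontinuities, and where `q` is continuous the two subgradient inequalities
  -- squeeze the derivative of `u` to `q`.
  have key : ∫ t in (0 : ℝ)..1, (q t * w t + u t * w' t) = u 1 * w 1 - u 0 * w 0 := by
    refine integral_eq_of_hasDerivAt_off_countable_of_le (fun t => u t * w t) _ zero_le_one
      qmono.countable_not_continuousWithinAt (ucont.mul wcont.continuousOn) ?_ ?_
    · rintro t ⟨ht, htc⟩
      have htI : t ∈ Icc (0 : ℝ) 1 := Ioo_subset_Icc_self ht
      have hc : ContinuousWithinAt q (Icc 0 1) t := by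
        by_contra hc
        exact htc ⟨htI, hc⟩
      have hnhds : Icc (0 : ℝ) 1 ∈ 𝓝 t := Icc_mem_nhds ht.1 ht.2
      have hca : ContinuousAt q t := hc.continuousAt hnhds
      have hd : HasDerivAt u (q t) t := by
        rw [hasDerivAt_iff_isLittleO, Asymptotics.isLittleO_iff]
        intro ε hε
        have := Metric.continuousAt_iff'.1 hca ε hε
        filter_upwards [this, hnhds] with s hs hsI
        rw [Real.dist_eq] at hs
        have h1 := h s hsI t htI
        have h2 := h t htI s hsI
        rw [smul_eq_mul, Real.norm_eq_abs, Real.norm_eq_abs, abs_of_nonneg (by linarith)]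
        calc u s - u t - (s - t) * q t ≤ (q s - q t) * (s - t) := by linarith
          _ ≤ |q s - q t| * |s - t| := by rw [← abs_mul]; exact le_abs_self _
          _ ≤ ε * |s - t| := by gcongr
      exact hd.mul (hw t)
    · rw [intervalIntegrable_iff_integrableOn_Icc_of_le zero_le_one]
      exact i1.add i2
  rw [w0, w1, intervalIntegral.integral_of_le zero_le_one, ← integral_Icc_eq_integral_Ioc,
    integral_add i1 i2] at key
  linarith

/-! ### Fubini on the square, by columns and by rows. -/

lemma isCompact_typeSpace : IsCompact typeSpace := isCompact_Icc.prod isCompact_Icc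

lemma measurableSet_typeSpace : MeasurableSet typeSpace := isCompact_typeSpace.measurableSet

/-- Fubini's theorem for a measurable part of the type space, by columns. -/
lemma setIntegral_eq_columns {F : ℝ × ℝ → ℝ} {S : Set (ℝ × ℝ)} (hS : MeasurableSet S)
    (hSX : S ⊆ typeSpace) (hF : IntegrableOn F typeSpace) :
    ∫ v in S, F v = ∫ x in Icc (0 : ℝ) 1, ∫ y in {y | (x, y) ∈ S}, F (x, y) := by
  have e1 : ∫ v in S, F v = ∫ v in typeSpace, S.indicator F v := by
    rw [setIntegral_indicator hS, inter_eq_self_of_subset_right hSX]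
  rw [e1, typeSpace, Measure.volume_eq_prod, setIntegral_prod]
  · refine setIntegral_congr_fun measurableSet_Icc fun x _ => ?_
    have hm : MeasurableSet {y | (x, y) ∈ S} := measurable_prodMk_left hS
    have e2 : ∀ y, S.indicator F (x, y) = {y | (x, y) ∈ S}.indicator (fun y => F (x, y)) y :=
      fun y => rfl
    simp only [e2]
    rw [setIntegral_indicator hm, inter_eq_self_of_subset_right]
    exact fun y hy => (hSX hy).2
  · exact hF.indicator hS

lemma setIntegral_swap (F : ℝ × ℝ → ℝ) (S : Set (ℝ × ℝ)) :
    ∫ v in Prod.swap ⁻¹' S, F v.swap = ∫ v in S, F v :=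
  (Measure.measurePreserving_swap (μ := (volume : Measure ℝ)) (ν := (volume : Measure ℝ))).setIntegral_preimage_emb
    MeasurableEquiv.prodComm.measurableEmbedding F S

lemma swap_preimage_typeSpace : Prod.swap ⁻¹' typeSpace = typeSpace := by
  ext v
  simp only [typeSpace, mem_preimage, mem_prod, Prod.fst_swap, Prod.snd_swap]
  exact and_comm

lemma integrableOn_swap {F : ℝ × ℝ → ℝ} (hF : IntegrableOn F typeSpace) :
    IntegrableOn (fun v => F v.swap) typeSpace := by
  have := ((Measure.measurePreserving_swap (μ := (volume : Measure ℝ))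
    (ν := (volume : Measure ℝ))).integrableOn_comp_preimage
    MeasurableEquiv.prodComm.measurableEmbedding (f := F) (s := typeSpace)).2 hF
  rwa [swap_preimage_typeSpace] at this

/-- Fubini's theorem for a measurable part of the type space, by rows. -/
lemma setIntegral_eq_rows {F : ℝ × ℝ → ℝ} {S : Set (ℝ × ℝ)} (hS : MeasurableSet S)
    (hSX : S ⊆ typeSpace) (hF : IntegrableOn F typeSpace) :
    ∫ v in S, F v = ∫ y in Icc (0 : ℝ) 1, ∫ x in {x | (x, y) ∈ S}, F (x, y) := by
  rw [← setIntegral_swap, setIntegral_eq_columns (measurable_swap hS) _ (integrableOn_swap hF)]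
  · rfl
  · rw [← swap_preimage_typeSpace]
    exact preimage_mono hSX

/-! ### The indirect utility of an incentive compatible mechanism. -/

namespace Mechanism

variable {N : Mechanism}

/-- Incentive compatibility in convex-analytic form: the allocation is a subgradient of the indirect
utility. -/
lemma IC.le_utility (hN : N.IC) {v w : ℝ × ℝ} (hv : v ∈ typeSpace) (hw : w ∈ typeSpace) :
    N.utility w w + ((N.alloc w).1 * (v.1 - w.1) + (N.alloc w).2 * (v.2 - w.2)) ≤
      N.utility v v := by
  have := hN v hv w hw
  unfold utility at *
  linarith

lemma IC.lipschitzOnWith (hN : N.IC) :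
    LipschitzOnWith 2 (fun v => N.utility v v) typeSpace := by
  refine LipschitzOnWith.of_le_add_mul 2 fun v hv w hw => ?_
  have h1 := hN.le_utility hw hv
  have h2 := N.alloc_mem v hv
  have h3 : |v.1 - w.1| ≤ dist v w := by rw [← Real.dist_eq]; exact le_max_left _ _
  have h4 : |v.2 - w.2| ≤ dist v w := by rw [← Real.dist_eq]; exact le_max_right _ _
  have h5 : ∀ a b : ℝ, a ∈ Icc (0 : ℝ) 1 → a * b ≤ |b| := fun a b ha => by
    nlinarith [le_abs_self b, abs_nonneg b, ha.1, ha.2]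
  have h6 := h5 _ (v.1 - w.1) h2.1
  have h7 := h5 _ (v.2 - w.2) h2.2
  push_cast
  linarith

lemma IC.continuousOn (hN : N.IC) : ContinuousOn (fun v => N.utility v v) typeSpace :=
  hN.lipschitzOnWith.continuousOn

/-- Almost everywhere the allocation is the gradient of the indirect utility. -/
lemma IC.ae_alloc_eq (hN : N.IC) : ∀ᵐ v ∂(volume.restrict typeSpace),
    (N.alloc v).1 = fderiv ℝ (fun v => N.utility v v) v (1, 0) ∧
      (N.alloc v).2 = fderiv ℝ (fun v => N.utility v v) v (0, 1) := by
  have hfr : volume (frontier typeSpace) = 0 :=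
    ((convex_Icc (0 : ℝ) 1).prod (convex_Icc 0 1)).addHaar_frontier volume
  have hint : ∀ᵐ v ∂(volume : Measure (ℝ × ℝ)), v ∉ frontier typeSpace :=
    measure_eq_zero_iff_ae_notMem.1 hfr
  filter_upwards [ae_restrict_of_ae hN.lipschitzOnWith.ae_differentiableWithinAt_of_mem_of_real,
    ae_restrict_of_ae hint, ae_restrict_mem measurableSet_typeSpace] with v hd hfr hv
  have hnhds : typeSpace ∈ 𝓝 v := by
    rw [← mem_interior_iff_mem_nhds]
    by_contra hc
    exact hfr ⟨subset_closure hv, hc⟩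
  have hd := (hd hv).differentiableAt hnhds
  set L : ℝ × ℝ →L[ℝ] ℝ := (N.alloc v).1 • ContinuousLinearMap.fst ℝ ℝ ℝ +
    (N.alloc v).2 • ContinuousLinearMap.snd ℝ ℝ ℝ with hL
  -- A subgradient at a point of differentiability is the gradient, since `u - L` has a minimum
  -- there; differentiability a.e. is Rademacher's theorem.
  have hmin : IsLocalMin (fun w => N.utility w w - L w) v := by
    filter_upwards [hnhds] with w hw
    have := hN.le_utility hw hv
    simp [hL]
    linarith
  have h0 := hmin.hasFDerivAt_eq_zero (hd.hasFDerivAt.sub L.hasFDerivAt)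
  rw [sub_eq_zero.1 h0]
  simp [hL]

/-- Competitors are not assumed measurable. Measurability is inherited from the derivative of the
indirect utility. -/
lemma IC.aestronglyMeasurable_alloc (hN : N.IC) :
    AEStronglyMeasurable (fun v => (N.alloc v).1) (volume.restrict typeSpace) ∧
      AEStronglyMeasurable (fun v => (N.alloc v).2) (volume.restrict typeSpace) :=
  ⟨(measurable_fderiv_apply_const ℝ _ (1, 0)).aestronglyMeasurable.congr
      (hN.ae_alloc_eq.mono fun _ h => h.1.symm),
    (measurable_fderiv_apply_const ℝ _ (0, 1)).aestronglyMeasurable.congr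
      (hN.ae_alloc_eq.mono fun _ h => h.2.symm)⟩

lemma IC.integrableOn_alloc (hN : N.IC) :
    IntegrableOn (fun v => (N.alloc v).1) typeSpace ∧
      IntegrableOn (fun v => (N.alloc v).2) typeSpace := by
  have : IsFiniteMeasure (volume.restrict typeSpace) :=
    ⟨by simpa using isCompact_typeSpace.measure_lt_top⟩
  constructor
  · refine Integrable.of_bound hN.aestronglyMeasurable_alloc.1 1 ?_
    filter_upwards [ae_restrict_mem measurableSet_typeSpace] with v hv
    have := (N.alloc_mem v hv).1
    rw [Real.norm_eq_abs, abs_of_nonneg this.1]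
    exact this.2
  · refine Integrable.of_bound hN.aestronglyMeasurable_alloc.2 1 ?_
    filter_upwards [ae_restrict_mem measurableSet_typeSpace] with v hv
    have := (N.alloc_mem v hv).2
    rw [Real.norm_eq_abs, abs_of_nonneg this.1]
    exact this.2

end Mechanism

/-! ### Revenue as an integral of the indirect utility. -/

/-- The density on the open square of the transformed measure of `jointDensity`. -/
noncomputable def massDensity (v : ℝ × ℝ) : ℝ := 4 * (4 * v.1 + 4 * v.2 - 5 * v.1 * v.2 - 3)

lemma continuous_massDensity : Continuous massDensity := by unfold massDensity; fun_prop

lemma continuous_jointDensity : Continuous jointDensity := by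
  unfold jointDensity itemDensity; fun_prop

namespace Mechanism

variable {N : Mechanism}

/-- Integration by parts along each row, with weight `4 t (1 - t) (1 - y)`. -/
lemma IC.integral_alloc_fst (hN : N.IC) :
    ∫ v in typeSpace, (N.alloc v).1 * (v.1 * jointDensity v) =
      -∫ v in typeSpace, N.utility v v * (4 * (1 - 2 * v.1) * (1 - v.2)) := by
  have c1 : Continuous fun v : ℝ × ℝ => v.1 * jointDensity v :=
    continuous_fst.mul continuous_jointDensity
  have c2 : ContinuousOn (fun v : ℝ × ℝ => N.utility v v * (4 * (1 - 2 * v.1) * (1 - v.2)))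
    typeSpace := hN.continuousOn.mul (by fun_prop)
  rw [setIntegral_eq_rows measurableSet_typeSpace subset_rfl
      (hN.integrableOn_alloc.1.mul_continuousOn c1.continuousOn isCompact_typeSpace),
    setIntegral_eq_rows measurableSet_typeSpace subset_rfl
      (c2.integrableOn_compact isCompact_typeSpace), ← integral_neg]
  refine setIntegral_congr_fun measurableSet_Icc fun y hy => ?_
  have e : {x | (x, y) ∈ typeSpace} = Icc (0 : ℝ) 1 := by
    ext x; exact ⟨fun h => h.1, fun h => ⟨h, hy⟩⟩
  simp only [e]
  refine integral_subgradient_mul (fun x hx => (N.alloc_mem (x, y) ⟨hx, hy⟩).1)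
    (fun s hs t ht => ?_) (fun t => ?_) (by fun_prop) ?_ ?_
  · simpa using hN.le_utility (v := (s, y)) (w := (t, y)) ⟨hs, hy⟩ ⟨ht, hy⟩
  · have h1 : HasDerivAt (fun t : ℝ => t * (1 - t)) (1 * (1 - t) + t * (-1)) t :=
      (hasDerivAt_id' t).mul ((hasDerivAt_id' t).const_sub 1)
    have h2 := h1.mul_const (4 * (1 - y))
    refine (h2.congr_deriv (by ring)).congr_of_eventuallyEq (.of_forall fun t => ?_)
    simp only [jointDensity, itemDensity]
    ring
  · simp
  · simp [jointDensity, itemDensity]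

lemma IC.integral_alloc_snd (hN : N.IC) :
    ∫ v in typeSpace, (N.alloc v).2 * (v.2 * jointDensity v) =
      -∫ v in typeSpace, N.utility v v * (4 * (1 - v.1) * (1 - 2 * v.2)) := by
  have c1 : Continuous fun v : ℝ × ℝ => v.2 * jointDensity v :=
    continuous_snd.mul continuous_jointDensity
  have c2 : ContinuousOn (fun v : ℝ × ℝ => N.utility v v * (4 * (1 - v.1) * (1 - 2 * v.2)))
    typeSpace := hN.continuousOn.mul (by fun_prop)
  rw [setIntegral_eq_columns measurableSet_typeSpace subset_rfl
      (hN.integrableOn_alloc.2.mul_continuousOn c1.continuousOn isCompact_typeSpace),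
    setIntegral_eq_columns measurableSet_typeSpace subset_rfl
      (c2.integrableOn_compact isCompact_typeSpace), ← integral_neg]
  refine setIntegral_congr_fun measurableSet_Icc fun x hx => ?_
  have e : {y | (x, y) ∈ typeSpace} = Icc (0 : ℝ) 1 := by
    ext y; exact ⟨fun h => h.2, fun h => ⟨hx, h⟩⟩
  simp only [e]
  refine integral_subgradient_mul (fun y hy => (N.alloc_mem (x, y) ⟨hx, hy⟩).2)
    (fun s hs t ht => ?_) (fun t => ?_) (by fun_prop) ?_ ?_
  · simpa using hN.le_utility (v := (x, s)) (w := (x, t)) ⟨hx, hs⟩ ⟨hx, ht⟩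
  · have h1 : HasDerivAt (fun t : ℝ => t * (1 - t)) (1 * (1 - t) + t * (-1)) t :=
      (hasDerivAt_id' t).mul ((hasDerivAt_id' t).const_sub 1)
    have h2 := h1.mul_const (4 * (1 - x))
    refine (h2.congr_deriv (by ring)).congr_of_eventuallyEq (.of_forall fun t => ?_)
    simp only [jointDensity, itemDensity]
    ring
  · simp
  · simp [jointDensity, itemDensity]

/-- The revenue of an incentive compatible mechanism is integrable, and equals the integral of the
indirect utility against `massDensity`. -/
lemma IC.revenue_eq (hN : N.IC) :
    IntegrableOn (fun v => N.price v * jointDensity v) typeSpace ∧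
      revenue jointDensity N = ∫ v in typeSpace, massDensity v * N.utility v v := by
  have i1 : IntegrableOn (fun v => (N.alloc v).1 * (v.1 * jointDensity v)) typeSpace :=
    hN.integrableOn_alloc.1.mul_continuousOn
      (continuous_fst.mul continuous_jointDensity).continuousOn isCompact_typeSpace
  have i2 : IntegrableOn (fun v => (N.alloc v).2 * (v.2 * jointDensity v)) typeSpace :=
    hN.integrableOn_alloc.2.mul_continuousOn
      (continuous_snd.mul continuous_jointDensity).continuousOn isCompact_typeSpace
  have i3 : IntegrableOn (fun v => N.utility v v * jointDensity v) typeSpace :=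
    (hN.continuousOn.mul continuous_jointDensity.continuousOn).integrableOn_compact
      isCompact_typeSpace
  have i4 : IntegrableOn (fun v : ℝ × ℝ => N.utility v v * (4 * (1 - 2 * v.1) * (1 - v.2)))
      typeSpace := (hN.continuousOn.mul (by fun_prop)).integrableOn_compact isCompact_typeSpace
  have i5 : IntegrableOn (fun v : ℝ × ℝ => N.utility v v * (4 * (1 - v.1) * (1 - 2 * v.2)))
      typeSpace := (hN.continuousOn.mul (by fun_prop)).integrableOn_compact isCompact_typeSpace
  have i12 : IntegrableOn (fun v => (N.alloc v).1 * (v.1 * jointDensity v) +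
      (N.alloc v).2 * (v.2 * jointDensity v)) typeSpace := i1.add i2
  have i45 : IntegrableOn (fun v : ℝ × ℝ => N.utility v v * (4 * (1 - 2 * v.1) * (1 - v.2)) +
      N.utility v v * (4 * (1 - v.1) * (1 - 2 * v.2))) typeSpace := i4.add i5
  have e : (fun v => N.price v * jointDensity v) = fun v =>
      (N.alloc v).1 * (v.1 * jointDensity v) + (N.alloc v).2 * (v.2 * jointDensity v) -
        N.utility v v * jointDensity v := by
    funext v; unfold utility; ring
  refine ⟨by rw [e]; exact i12.sub i3, ?_⟩
  unfold revenue
  rw [e, integral_sub i12 i3, integral_add i1 i2, hN.integral_alloc_fst,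
    hN.integral_alloc_snd, ← neg_add, ← integral_add i4 i5, sub_eq_add_neg, ← neg_add,
    ← integral_add i45 i3, ← integral_neg]
  congr 1
  funext v
  unfold massDensity jointDensity itemDensity
  ring

end Mechanism

/-! ### The boundary curve -/

lemma le_bdry_iff {x y : ℝ} (hx : x ≤ 2 / 3) : y ≤ bdry x ↔ (4 - 5 * x) * y ≤ 2 - 3 * x := by
  unfold bdry
  rw [le_div_iff₀ (by linarith), mul_comm]

lemma bdry_le_iff {x y : ℝ} (hx : x ≤ 2 / 3) : bdry x ≤ y ↔ 2 - 3 * x ≤ (4 - 5 * x) * y := by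
  unfold bdry
  rw [div_le_iff₀ (by linarith), mul_comm y]

lemma mul_bdry {x : ℝ} (hx : x ≤ 2 / 3) : (4 - 5 * x) * bdry x = 2 - 3 * x := by
  unfold bdry
  field_simp [show (4 - 5 * x) ≠ 0 by linarith]

lemma bdry_anti {x y : ℝ} (hxy : x ≤ y) (hy : y ≤ 2 / 3) : bdry y ≤ bdry x := by
  have hx : x ≤ 2 / 3 := hxy.trans hy
  rw [le_bdry_iff hx]
  have h := mul_bdry hy
  have h4 : 0 < 4 - 5 * y := by linarith
  rw [← sub_nonneg]
  have : (4 - 5 * y) * (2 - 3 * x - (4 - 5 * x) * bdry y) = 2 * (y - x) := by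
    linear_combination (-(4 - 5 * x)) * h
  nlinarith

lemma bdry_nonneg {x : ℝ} (hx : x ≤ 2 / 3) : 0 ≤ bdry x := by
  rw [le_bdry_iff hx]; linarith

lemma bdry_le_half {x : ℝ} (h0 : 0 ≤ x) (hx : x ≤ 2 / 3) : bdry x ≤ 1 / 2 := by
  rw [bdry_le_iff hx]; linarith

lemma measurable_bdry : Measurable bdry := by
  unfold bdry; fun_prop

lemma hasDerivAt_bdry {x : ℝ} (hx : x ≤ 2 / 3) :
    HasDerivAt bdry (-(2 / (4 - 5 * x) ^ 2)) x := by
  have hne : 4 - 5 * x ≠ 0 := by linarith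
  have h1 : HasDerivAt (fun x : ℝ => 2 - 3 * x) (-(3 * 1)) x :=
    ((hasDerivAt_id' x).const_mul 3).const_sub 2
  have h2 : HasDerivAt (fun x : ℝ => 4 - 5 * x) (-(5 * 1)) x :=
    ((hasDerivAt_id' x).const_mul 5).const_sub 4
  refine (h1.div h2 hne).congr_deriv ?_
  field_simp
  ring

/-- The tangent of the concave curve `bdry` lies above it. -/
lemma bdry_le_tangent {x t : ℝ} (hx : x ≤ 2 / 3) (ht : t ≤ 2 / 3) :
    bdry x ≤ bdry t - 2 / (4 - 5 * t) ^ 2 * (x - t) := by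
  have h1 : 0 < 4 - 5 * t := by linarith
  have h2 : 0 < 4 - 5 * x := by linarith
  rw [bdry_le_iff hx]
  have e : (4 - 5 * x) * (bdry t - 2 / (4 - 5 * t) ^ 2 * (x - t)) - (2 - 3 * x) =
      10 * (x - t) ^ 2 / (4 - 5 * t) ^ 2 := by
    unfold bdry
    field_simp
    ring
  have : 0 ≤ 10 * (x - t) ^ 2 / (4 - 5 * t) ^ 2 := by positivity
  linarith

/-! ### The critical price and the critical point -/

/-- The price `p` is critical with critical point `(c, c)`: the point `(c, p - c)` lies on the curve
`bdry` and the region `𝒲` has transformed mass zero. -/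
structure IsCritical (p c : ℝ) : Prop where
  lo : 0.06185 ≤ c
  hi : c ≤ 0.06189
  curve : (4 - 5 * c) * (p - c) = 2 - 3 * c
  -- The left side is the mass of the square `[c,1]²`; the right side is the mass of the triangle of
  -- leg `p - 2c` that the line `x + y = p` cuts off at `(c,c)`.
  mass : (1 - c) ^ 3 * (5 * c - 1) = 4 * ((8 * c - 5 * c ^ 2 - 3) * (p - 2 * c) ^ 2 / 2 +
    (4 - 5 * c) * (p - 2 * c) ^ 3 / 3 - 5 * (p - 2 * c) ^ 4 / 24)

lemma exists_isCritical : ∃ p c, IsCritical p c := by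
  set E : ℝ → ℝ := fun c => (1 - c) ^ 3 * (5 * c - 1) -
    4 * ((8 * c - 5 * c ^ 2 - 3) * (bdry c - c) ^ 2 / 2 +
      (4 - 5 * c) * (bdry c - c) ^ 3 / 3 - 5 * (bdry c - c) ^ 4 / 24) with hE
  have hb : ContinuousOn bdry (Icc 0.06185 0.06189) := fun x hx =>
    (hasDerivAt_bdry (by linarith [hx.2])).continuousAt.continuousWithinAt
  have hcont : ContinuousOn E (Icc 0.06185 0.06189) := by
    rw [hE]
    fun_prop
  have h0 : E 0.06185 ≤ 0 := by norm_num [hE, bdry]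
  have h1 : 0 ≤ E 0.06189 := by norm_num [hE, bdry]
  obtain ⟨c, hc, hc0⟩ := intermediate_value_Icc (by norm_num) hcont ⟨h0, h1⟩
  refine ⟨c + bdry c, c, hc.1, hc.2, ?_, ?_⟩
  · rw [add_sub_cancel_left, mul_bdry (by linarith [hc.2])]
  · have e : c + bdry c - 2 * c = bdry c - c := by ring
    rw [e]
    exact sub_eq_zero.1 hc0

namespace IsCritical

variable {p c : ℝ}

lemma c_pos (h : IsCritical p c) : 0 < c := by linarith [h.lo]

lemma lt_sub (h : IsCritical p c) : 0.49161 < p - c := by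
  nlinarith [h.lo, h.hi, h.curve]

lemma sub_lt (h : IsCritical p c) : p - c < 0.49163 := by
  nlinarith [h.lo, h.hi, h.curve]

lemma bdry_c (h : IsCritical p c) : bdry c = p - c := by
  have := mul_bdry (x := c) (by linarith [h.hi])
  have h4 : (4 - 5 * c) ≠ 0 := by linarith [h.hi]
  exact mul_left_cancel₀ h4 (this.trans h.curve.symm)

/-- The line `x + y = p` meets the hyperbola extending the curve at `x = c` and `x = p - c + 1/5`.
Hence the line is above the curve to the left of `c` and below it between the two roots. -/
lemma factor (h : IsCritical p c) (x : ℝ) :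
    (4 - 5 * x) * (p - x) - (2 - 3 * x) = 5 * (x - c) * (x - (p - c + 1 / 5)) := by
  linear_combination h.curve

/-- The margin `1/6` keeps `x` below both the second root and `2/3`, while covering `x ≤ p - c` with
room to spare. -/
lemma line_le_bdry (h : IsCritical p c) {x : ℝ} (h1 : c ≤ x) (h2 : x ≤ p - c + 1 / 6) :
    p - x ≤ bdry x := by
  rw [le_bdry_iff (by linarith [h.sub_lt])]
  nlinarith [h.factor x]

lemma bdry_le_line (h : IsCritical p c) {x : ℝ} (h1 : x ≤ c) : bdry x ≤ p - x := by
  rw [bdry_le_iff (by linarith [h.hi])]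
  nlinarith [h.factor x, h.lt_sub, h.hi]

lemma bdry_lt_line (h : IsCritical p c) {x : ℝ} (h1 : x < c) : bdry x < p - x := by
  refine lt_of_not_ge fun hle => ?_
  rw [le_bdry_iff (by linarith [h.hi])] at hle
  nlinarith [h.factor x, h.lt_sub, h.hi,
    mul_pos (sub_pos.2 h1) (show 0 < p - c + 1 / 5 - x by linarith [h.lt_sub, h.hi])]

lemma lt_bdry (h : IsCritical p c) {x : ℝ} (h1 : x ≤ c) : 0.49161 < bdry x :=
  h.lt_sub.trans_le (h.bdry_c ▸ bdry_anti h1 (by linarith [h.hi]))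

/-- Points left of `c` on or below the curve lie left of the reflected curve. -/
lemma le_bdry_of_lt (h : IsCritical p c) {x y : ℝ} (h0 : 0 ≤ x) (h1 : x ≤ c)
    (hy : y ≤ bdry x) : y ≤ 1 / 2 ∧ x ≤ bdry y := by
  have h2 : y ≤ 1 / 2 := hy.trans (bdry_le_half h0 (by linarith [h.hi]))
  refine ⟨h2, ?_⟩
  have h3 : 1 / 3 ≤ bdry y := by
    rw [le_bdry_iff (by linarith)]
    linarith
  linarith [h.hi]

end IsCritical

/-! ### The regions -/

section Regions

variable {p c : ℝ}

lemma regionA_subset (h : IsCritical p c) : regionA c ⊆ typeSpace := fun v hv =>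
  ⟨⟨hv.1.1, by linarith [hv.1.2, h.hi]⟩, ⟨by linarith [hv.2.1, h.lt_bdry hv.1.2.le], hv.2.2⟩⟩

lemma regionB_subset (h : IsCritical p c) : regionB c ⊆ typeSpace := fun v hv =>
  ⟨⟨by linarith [hv.2.1, h.lt_bdry hv.1.2.le], hv.2.2⟩, ⟨hv.1.1, by linarith [hv.1.2, h.hi]⟩⟩

lemma regionW_subset (h : IsCritical p c) : regionW p c ⊆ typeSpace := fun v hv =>
  ⟨⟨by linarith [hv.1.1, h.c_pos], hv.1.2⟩, ⟨by linarith [hv.2.1.1, h.c_pos], hv.2.1.2⟩⟩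

lemma disjoint_regionA_regionB (h : IsCritical p c) : Disjoint (regionA c) (regionB c) :=
  disjoint_left.2 fun v hA hB => by
    linarith [hA.2.1, h.lt_bdry hA.1.2.le, hB.1.2, h.hi]

lemma disjoint_regionA_regionW : Disjoint (regionA c) (regionW p c) :=
  disjoint_left.2 fun _ hA hW => not_le.2 hA.1.2 hW.1.1

lemma disjoint_regionB_regionW : Disjoint (regionB c) (regionW p c) :=
  disjoint_left.2 fun _ hB hW => not_le.2 hB.1.2 hW.2.1.1

lemma measurableSet_regionA : MeasurableSet (regionA c) :=
  (measurableSet_Ico.preimage measurable_fst).inter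
    ((measurableSet_le (measurable_bdry.comp measurable_fst) measurable_snd).inter
      (measurableSet_le measurable_snd measurable_const))

lemma measurableSet_regionB : MeasurableSet (regionB c) :=
  (measurableSet_Ico.preimage measurable_snd).inter
    ((measurableSet_le (measurable_bdry.comp measurable_snd) measurable_fst).inter
      (measurableSet_le measurable_fst measurable_const))

lemma measurableSet_regionW : MeasurableSet (regionW p c) :=
  (measurableSet_Icc.preimage measurable_fst).inter
    ((measurableSet_Icc.preimage measurable_snd).inter
      (measurableSet_le measurable_const (measurable_fst.add measurable_snd)))

lemma measurableSet_regionZ : MeasurableSet (regionZ p c) :=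
  measurableSet_typeSpace.diff
    ((measurableSet_regionW.union measurableSet_regionA).union measurableSet_regionB)

/-- The type space is partitioned into the four regions. -/
lemma region_cases {v : ℝ × ℝ} (hv : v ∈ typeSpace) :
    v ∈ regionZ p c ∨ v ∈ regionA c ∨ v ∈ regionB c ∨ v ∈ regionW p c := by
  unfold regionZ
  simp only [Set.mem_sdiff, mem_union, hv, true_and]
  tauto

lemma mem_regionZ_iff {v : ℝ × ℝ} (hv : v ∈ typeSpace) :
    v ∈ regionZ p c ↔ (v.1 < c → v.2 < bdry v.1) ∧ (v.2 < c → v.1 < bdry v.2) ∧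
      (c ≤ v.1 → c ≤ v.2 → v.1 + v.2 < p) := by
  obtain ⟨⟨h1, h2⟩, h3, h4⟩ := hv
  have hv : v ∈ typeSpace := ⟨⟨h1, h2⟩, h3, h4⟩
  simp only [regionZ, Set.mem_sdiff, hv, true_and, mem_union, not_or, regionA, regionB, regionW,
    mem_ofPred_eq, mem_Ico, mem_Icc, h1, h2, h3, h4, and_true, not_and, not_le]
  tauto

lemma regionZ_subset_below (h : IsCritical p c) : regionZ p c ⊆ below p := by
  intro v hv
  have hX : v ∈ typeSpace := hv.1
  obtain ⟨hA, hB, hW⟩ := (mem_regionZ_iff hX).1 hv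
  refine ⟨hX, ?_⟩
  have hc := h.hi
  rcases lt_or_ge v.1 c with h1 | h1
  · have h2 := hA h1
    obtain ⟨h3, h4⟩ := h.le_bdry_of_lt hX.1.1 h1.le h2.le
    exact ⟨⟨by linarith, h2.le⟩, ⟨by linarith, h4⟩, by linarith [h.bdry_le_line h1.le]⟩
  · rcases lt_or_ge v.2 c with h1' | h1'
    · have h2 := hB h1'
      obtain ⟨h3, h4⟩ := h.le_bdry_of_lt hX.2.1 h1'.le h2.le
      exact ⟨⟨by linarith, h4⟩, ⟨by linarith, h2.le⟩, by linarith [h.bdry_le_line h1'.le]⟩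
    · have h2 := hW h1 h1'
      have h3 := h.sub_lt
      refine ⟨⟨by linarith, ?_⟩, ⟨by linarith, ?_⟩, h2.le⟩
      · linarith [h.line_le_bdry h1 (by linarith)]
      · linarith [h.line_le_bdry h1' (by linarith)]

lemma isClosed_below (p : ℝ) : IsClosed (below p) := by
  have e : below p = {v | v ∈ typeSpace ∧ (v.1 ≤ 2 / 3 ∧ (4 - 5 * v.1) * v.2 ≤ 2 - 3 * v.1) ∧
      (v.2 ≤ 2 / 3 ∧ (4 - 5 * v.2) * v.1 ≤ 2 - 3 * v.2) ∧ v.1 + v.2 ≤ p} := by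
    ext v
    constructor
    · rintro ⟨h, ⟨h1, h2⟩, ⟨h3, h4⟩, h5⟩
      exact ⟨h, ⟨h1, (le_bdry_iff h1).1 h2⟩, ⟨h3, (le_bdry_iff h3).1 h4⟩, h5⟩
    · rintro ⟨h, ⟨h1, h2⟩, ⟨h3, h4⟩, h5⟩
      exact ⟨h, ⟨h1, (le_bdry_iff h1).2 h2⟩, ⟨h3, (le_bdry_iff h3).2 h4⟩, h5⟩
  rw [e]
  have h1 : IsClosed {v : ℝ × ℝ | v.1 ≤ 2 / 3} := isClosed_le (by fun_prop) (by fun_prop)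
  have h2 : IsClosed {v : ℝ × ℝ | (4 - 5 * v.1) * v.2 ≤ 2 - 3 * v.1} :=
    isClosed_le (by fun_prop) (by fun_prop)
  have h3 : IsClosed {v : ℝ × ℝ | v.2 ≤ 2 / 3} := isClosed_le (by fun_prop) (by fun_prop)
  have h4 : IsClosed {v : ℝ × ℝ | (4 - 5 * v.2) * v.1 ≤ 2 - 3 * v.2} :=
    isClosed_le (by fun_prop) (by fun_prop)
  have h5 : IsClosed {v : ℝ × ℝ | v.1 + v.2 ≤ p} := isClosed_le (by fun_prop) (by fun_prop)
  exact isCompact_typeSpace.isClosed.inter ((h1.inter h2).inter ((h3.inter h4).inter h5))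

lemma measurableSet_below (p : ℝ) : MeasurableSet (below p) := (isClosed_below p).measurableSet

/-- Contracting towards the origin makes the curve inequality strict, because `bdry` is decreasing
and positive at `r * x`. This shows that `below p` is the closure of `Z`. -/
lemma mul_lt_bdry {x y r : ℝ} (hr0 : 0 ≤ r) (hr1 : r < 1) (hx0 : 0 ≤ x) (hx : x ≤ 2 / 3)
    (hy : y ≤ bdry x) : r * y < bdry (r * x) := by
  have h1 : r * x < 2 / 3 := by nlinarith
  have h2 : 0 < bdry (r * x) := div_pos (by linarith) (by linarith)
  have h3 : y ≤ bdry (r * x) := hy.trans (bdry_anti (by nlinarith) hx)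
  nlinarith

/-- The closure of the exclusion region. -/
lemma closure_regionZ (h : IsCritical p c) : closure (regionZ p c) = below p := by
  refine subset_antisymm (closure_minimal (regionZ_subset_below h) (isClosed_below p)) ?_
  rintro v ⟨hX, ⟨h1, h2⟩, ⟨h3, h4⟩, h5⟩
  have hlim : Tendsto (fun r : ℝ => r • v) (𝓝[<] 1) (𝓝 v) := by
    have : Continuous fun r : ℝ => r • v := by fun_prop
    simpa using (this.tendsto 1).mono_left nhdsWithin_le_nhds
  refine mem_closure_of_tendsto hlim ?_
  filter_upwards [Ioo_mem_nhdsLT (zero_lt_one (α := ℝ))] with r hr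
  obtain ⟨⟨hx0, hx1⟩, hy0, hy1⟩ := hX
  have hX' : r • v ∈ typeSpace := by
    refine ⟨⟨?_, ?_⟩, ?_, ?_⟩ <;> simp only [Prod.smul_fst, Prod.smul_snd, smul_eq_mul] <;>
      nlinarith [hr.1, hr.2]
  rw [mem_regionZ_iff hX']
  simp only [Prod.smul_fst, Prod.smul_snd, smul_eq_mul]
  refine ⟨fun _ => mul_lt_bdry hr.1.le hr.2 hx0 h1 h2, fun _ => mul_lt_bdry hr.1.le hr.2 hy0 h3 h4,
    fun _ _ => ?_⟩
  nlinarith [hr.1, hr.2, h.lt_sub, h.lo]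

lemma isLeast_fst (h : IsCritical p c) : IsLeast {x : ℝ | (x, p - x) ∈ below p} c := by
  have hc := h.hi
  have hc' := h.lo
  have h1 := h.lt_sub
  have h2 := h.sub_lt
  constructor
  · obtain ⟨h3, h4⟩ := h.le_bdry_of_lt h.c_pos.le le_rfl h.bdry_c.ge
    exact ⟨⟨⟨h.c_pos.le, by linarith⟩, ⟨by linarith, by linarith⟩⟩, ⟨by linarith, h.bdry_c.ge⟩,
      ⟨by linarith, h4⟩, by simp⟩
  · rintro x ⟨_, ⟨_, h3⟩, _⟩
    by_contra! hx
    exact (h.bdry_lt_line hx).not_ge h3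

lemma swap_mem_below {v : ℝ × ℝ} : v.swap ∈ below p ↔ v ∈ below p := by
  simp only [below, typeSpace, mem_ofPred_eq, mem_prod, Prod.fst_swap, Prod.snd_swap,
    add_comm v.2 v.1]
  tauto

lemma isLeast_snd (h : IsCritical p c) : IsLeast {y : ℝ | (p - y, y) ∈ below p} c := by
  have : {y : ℝ | (p - y, y) ∈ below p} = {x : ℝ | (x, p - x) ∈ below p} := by
    ext y
    exact swap_mem_below (v := (y, p - y))
  rw [this]
  exact isLeast_fst h

end Regions

/-! ### The transformed measure -/

lemma integrableOn_massDensity {S : Set (ℝ × ℝ)} (hS : S ⊆ typeSpace) :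
    IntegrableOn massDensity S :=
  (continuous_massDensity.continuousOn.integrableOn_compact isCompact_typeSpace).mono_set hS

lemma massDensity_swap (v : ℝ × ℝ) : massDensity v.swap = massDensity v := by
  simp only [massDensity, Prod.fst_swap, Prod.snd_swap]; ring

/-- The mass of an upper part of a column. -/
lemma integral_massDensity_column (x : ℝ) {a : ℝ} (ha : a ≤ 1) :
    ∫ y in Icc a 1, massDensity (x, y) = 2 * (1 - a) * ((4 - 5 * x) * a + 3 * x - 2) := by
  rw [integral_Icc_eq_integral_Ioc, ← intervalIntegral.integral_of_le ha]
  have hd : ∀ y ∈ uIcc a 1, HasDerivAt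
      (fun y : ℝ => 2 * (4 - 5 * x) * y ^ 2 + 4 * (4 * x - 3) * y) (massDensity (x, y)) y := by
    intro y _
    refine (((hasDerivAt_pow 2 y).const_mul (2 * (4 - 5 * x))).add
      ((hasDerivAt_id' y).const_mul (4 * (4 * x - 3)))).congr_deriv ?_
    simp only [massDensity]
    push_cast
    ring
  rw [intervalIntegral.integral_eq_sub_of_hasDerivAt hd
    ((continuous_massDensity.comp (by fun_prop : Continuous fun y : ℝ => (x, y))).intervalIntegrable
      _ _)]
  ring

/-- The origin of the curve: `bdry x` is the root in `a` of the last factor of the column mass.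
Starting below it gives a nonpositive mass, starting above it a nonnegative one. -/
lemma integral_massDensity_column_bdry {x : ℝ} (h0 : 0 ≤ x) (hx : x ≤ 2 / 3) :
    ∫ y in Icc (bdry x) 1, massDensity (x, y) = 0 := by
  rw [integral_massDensity_column x (by linarith [bdry_le_half h0 hx])]
  linear_combination 2 * (1 - bdry x) * mul_bdry hx

lemma slice_regionA {c x : ℝ} (hx : x ∈ Icc (0 : ℝ) 1) :
    {y | (x, y) ∈ regionA c} = if x < c then Icc (bdry x) 1 else ∅ := by
  ext y
  split_ifs with h
  · exact ⟨fun hy => hy.2, fun hy => ⟨⟨hx.1, h⟩, hy⟩⟩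
  · exact ⟨fun hy => absurd hy.1.2 h, fun hy => hy.elim⟩

lemma swap_preimage_regionA (c : ℝ) : Prod.swap ⁻¹' regionA c = regionB c := rfl

section

variable {p c : ℝ}

lemma integral_massDensity_regionA (h : IsCritical p c) : ∫ v in regionA c, massDensity v = 0 := by
  rw [setIntegral_eq_columns measurableSet_regionA (regionA_subset h)
    (integrableOn_massDensity subset_rfl)]
  refine setIntegral_eq_zero_of_forall_eq_zero fun x hx => ?_
  rw [slice_regionA hx]
  split_ifs with hc
  · exact integral_massDensity_column_bdry hx.1 (by linarith [h.hi])
  · simp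

lemma integral_massDensity_regionB (h : IsCritical p c) : ∫ v in regionB c, massDensity v = 0 := by
  rw [← integral_massDensity_regionA h, ← setIntegral_swap massDensity (regionA c),
    swap_preimage_regionA]
  simp only [massDensity_swap]

lemma slice_regionW (x : ℝ) :
    {y | (x, y) ∈ regionW p c} = if x ∈ Icc c 1 then Icc (max c (p - x)) 1 else ∅ := by
  ext y
  simp only [regionW, mem_ofPred_eq]
  split_ifs with h
  · simp only [mem_Icc, max_le_iff, sub_le_iff_le_add, h, true_and, add_comm x y]
    tauto
  · simp [h]

lemma integral_massDensity_regionW (h : IsCritical p c) :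
    ∫ v in regionW p c, massDensity v = 0 := by
  have h1 := h.lo
  have h2 := h.hi
  have h3 := h.lt_sub
  have h4 := h.sub_lt
  rw [setIntegral_eq_columns measurableSet_regionW (regionW_subset h)
    (integrableOn_massDensity subset_rfl)]
  set G : ℝ → ℝ := fun x => 2 * (1 - max c (p - x)) * ((4 - 5 * x) * max c (p - x) + 3 * x - 2)
    with hG
  have e1 : ∫ x in Icc (0 : ℝ) 1, ∫ y in {y | (x, y) ∈ regionW p c}, massDensity (x, y) =
      ∫ x in Icc (0 : ℝ) 1, (Icc c 1).indicator G x := by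
    refine setIntegral_congr_fun measurableSet_Icc fun x hx => ?_
    simp only [slice_regionW]
    split_ifs with hc
    · rw [integral_massDensity_column x (max_le (by linarith) (by linarith [hc.1])),
        indicator_of_mem hc]
    · rw [indicator_of_notMem hc, setIntegral_empty]
  rw [e1, setIntegral_indicator measurableSet_Icc,
    inter_eq_self_of_subset_right (Icc_subset_Icc_left h.c_pos.le), integral_Icc_eq_integral_Ioc,
    ← intervalIntegral.integral_of_le (by linarith)]
  have hGc : Continuous G := by rw [hG]; fun_prop
  -- Columns of `𝒲` start on the line for `x ≤ p - c` and at height `c` afterwards.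
  rw [← intervalIntegral.integral_add_adjacent_intervals (b := p - c)
    (hGc.intervalIntegrable _ _) (hGc.intervalIntegrable _ _)]
  have e2 : ∫ x in c..(p - c), G x =
      ∫ x in c..(p - c), 2 * (1 - (p - x)) * ((4 - 5 * x) * (p - x) + 3 * x - 2) := by
    refine intervalIntegral.integral_congr fun x hx => ?_
    rw [uIcc_of_le (by linarith)] at hx
    simp only [hG, max_eq_right (show c ≤ p - x by linarith [hx.2])]
  have e3 : ∫ x in (p - c)..1, G x =
      ∫ x in (p - c)..1, 2 * (1 - c) * ((4 - 5 * x) * c + 3 * x - 2) := by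
    refine intervalIntegral.integral_congr fun x hx => ?_
    rw [uIcc_of_le (by linarith)] at hx
    simp only [hG, max_eq_left (show p - x ≤ c by linarith [hx.1])]
  have d2 : ∀ x : ℝ, HasDerivAt (fun x => 2 * ((1 - p) * (4 * p - 2) * x +
      ((4 * p - 2) - (1 - p) * (1 + 5 * p)) * x ^ 2 / 2 +
      (5 * (1 - p) - (1 + 5 * p)) * x ^ 3 / 3 + 5 * x ^ 4 / 4))
      (2 * (1 - (p - x)) * ((4 - 5 * x) * (p - x) + 3 * x - 2)) x := by
    intro x
    refine (((((((hasDerivAt_id' x).const_mul ((1 - p) * (4 * p - 2))).add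
      (((hasDerivAt_pow 2 x).const_mul ((4 * p - 2) - (1 - p) * (1 + 5 * p))).div_const 2)).add
      (((hasDerivAt_pow 3 x).const_mul (5 * (1 - p) - (1 + 5 * p))).div_const 3)).add
      (((hasDerivAt_pow 4 x).const_mul 5).div_const 4)).const_mul 2)).congr_deriv ?_
    push_cast
    ring
  have d3 : ∀ x : ℝ, HasDerivAt (fun x => 2 * (1 - c) * ((4 * c - 2) * x +
      (3 - 5 * c) * x ^ 2 / 2)) (2 * (1 - c) * ((4 - 5 * x) * c + 3 * x - 2)) x := by
    intro x
    refine (((((hasDerivAt_id' x).const_mul (4 * c - 2)).add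
      (((hasDerivAt_pow 2 x).const_mul (3 - 5 * c)).div_const 2)).const_mul
      (2 * (1 - c)))).congr_deriv ?_
    push_cast
    ring
  rw [e2, e3, intervalIntegral.integral_eq_sub_of_hasDerivAt (fun x _ => d2 x)
      (Continuous.intervalIntegrable (by fun_prop) _ _),
    intervalIntegral.integral_eq_sub_of_hasDerivAt (fun x _ => d3 x)
      (Continuous.intervalIntegrable (by fun_prop) _ _)]
  linear_combination h.mass

lemma integral_massDensity_typeSpace : ∫ v in typeSpace, massDensity v = -1 := by
  rw [setIntegral_eq_columns measurableSet_typeSpace subset_rfl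
    (integrableOn_massDensity subset_rfl)]
  have e : ∫ x in Icc (0 : ℝ) 1, ∫ y in {y | (x, y) ∈ typeSpace}, massDensity (x, y) =
      ∫ x in Icc (0 : ℝ) 1, (6 * x - 4) := by
    refine setIntegral_congr_fun measurableSet_Icc fun x hx => ?_
    have : {y | (x, y) ∈ typeSpace} = Icc (0 : ℝ) 1 := by
      ext y; exact ⟨fun h => h.2, fun h => ⟨hx, h⟩⟩
    simp only [this]
    rw [integral_massDensity_column x zero_le_one]
    ring
  rw [e, integral_Icc_eq_integral_Ioc, ← intervalIntegral.integral_of_le zero_le_one]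
  rw [intervalIntegral.integral_sub (Continuous.intervalIntegrable (by fun_prop) _ _)
    (Continuous.intervalIntegrable (by fun_prop) _ _), intervalIntegral.integral_const_mul,
    integral_id, intervalIntegral.integral_const]
  norm_num

/-- Integrals over the type space split over the four regions. -/
lemma integral_eq_add_regions (h : IsCritical p c) {F : ℝ × ℝ → ℝ}
    (hF : IntegrableOn F typeSpace) :
    ∫ v in typeSpace, F v = (∫ v in regionZ p c, F v) + (∫ v in regionA c, F v) +
      (∫ v in regionB c, F v) + ∫ v in regionW p c, F v := by
  have hA := hF.mono_set (regionA_subset h)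
  have hB := hF.mono_set (regionB_subset h)
  have hW := hF.mono_set (regionW_subset h)
  have hsub : regionW p c ∪ regionA c ∪ regionB c ⊆ typeSpace :=
    union_subset (union_subset (regionW_subset h) (regionA_subset h)) (regionB_subset h)
  have hm : MeasurableSet (regionW p c ∪ regionA c ∪ regionB c) :=
    (measurableSet_regionW.union measurableSet_regionA).union measurableSet_regionB
  have e := setIntegral_sdiff hm hF hsub
  rw [setIntegral_union (disjoint_union_left.2 ⟨disjoint_regionB_regionW.symm,
      disjoint_regionA_regionB h⟩) measurableSet_regionB (hW.union hA) hB,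
    setIntegral_union disjoint_regionA_regionW.symm measurableSet_regionA hW hA] at e
  change ∫ v in regionZ p c, F v = _ at e
  rw [e]
  ring

/-- The other three regions carry no mass, so `Z` carries all of it, exactly cancelling the unit
atom at the origin. -/
lemma integral_massDensity_regionZ (h : IsCritical p c) :
    ∫ v in regionZ p c, massDensity v = -1 := by
  have := integral_eq_add_regions h (integrableOn_massDensity subset_rfl)
  rw [integral_massDensity_typeSpace, integral_massDensity_regionA h,
    integral_massDensity_regionB h, integral_massDensity_regionW h] at this
  linarith

lemma volume_graph_eq_zero {f : ℝ → ℝ} (hf : Measurable f) :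
    volume {v : ℝ × ℝ | v.2 = f v.1} = 0 := by
  have hm : MeasurableSet {v : ℝ × ℝ | v.2 = f v.1} :=
    measurableSet_eq_fun measurable_snd (hf.comp measurable_fst)
  rw [Measure.volume_eq_prod, Measure.measure_prod_null hm]
  refine .of_forall fun x => ?_
  have : Prod.mk x ⁻¹' {v : ℝ × ℝ | v.2 = f v.1} = {f x} := by ext y; rfl
  simp [this]

lemma volume_graph_swap_eq_zero {f : ℝ → ℝ} (hf : Measurable f) :
    volume {v : ℝ × ℝ | v.1 = f v.2} = 0 := by
  have := (Measure.measurePreserving_swap (μ := (volume : Measure ℝ))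
    (ν := (volume : Measure ℝ))).measure_preimage
    (measurableSet_eq_fun measurable_snd (hf.comp measurable_fst)).nullMeasurableSet
  exact this.trans (volume_graph_eq_zero hf)

/-- `Z` and its closure differ inside the union of three graphs, which is a null set. -/
lemma integral_massDensity_below (h : IsCritical p c) :
    ∫ v in below p, massDensity v = -1 := by
  rw [← integral_massDensity_regionZ h]
  refine setIntegral_congr_set ?_
  refine (ae_eq_set.2 ⟨?_, ?_⟩).symm
  · rw [sdiff_eq_empty.2 (regionZ_subset_below h), measure_empty]
  · have hl : Measurable fun x : ℝ => p - x := by fun_prop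
    refine measure_mono_null ?_ (measure_union_null (measure_union_null
      (volume_graph_eq_zero measurable_bdry) (volume_graph_swap_eq_zero measurable_bdry))
      (volume_graph_eq_zero hl))
    rintro v ⟨⟨hX, ⟨_, h2⟩, ⟨_, h4⟩, h5⟩, hZ⟩
    rcases region_cases (p := p) (c := c) hX with hv | hv | hv | hv
    · exact absurd hv hZ
    · exact .inl (.inl (le_antisymm h2 hv.2.1))
    · exact .inl (.inr (le_antisymm h4 hv.2.1))
    · exact .inr (show v.2 = p - v.1 by linarith [hv.2.2])

end

/-- Under the curve the density is at most `4(x - 1)`, and `x ≤ 2/3`. -/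
lemma massDensity_le_of_below {p : ℝ} {v : ℝ × ℝ} (hv : v ∈ below p) : massDensity v ≤ -4 / 3 := by
  obtain ⟨_, ⟨h1, h2⟩, _⟩ := hv
  have := (le_bdry_iff h1).1 h2
  unfold massDensity
  linarith

lemma below_subset_typeSpace (p : ℝ) : below p ⊆ typeSpace := fun _ hv => hv.1

/-- The mass below the curves and the line of price `p` strictly decreases in `p` until the line
leaves the region. -/
lemma integral_massDensity_below_lt {p q : ℝ} (hp : 0 < p) (hpq : p < q) (hp' : p < 4 / 5) :
    ∫ v in below q, massDensity v < ∫ v in below p, massDensity v := by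
  have hsub : below p ⊆ below q := fun v hv =>
    ⟨hv.1, hv.2.1, hv.2.2.1, hv.2.2.2.trans hpq.le⟩
  have hD : below q \ below p ⊆ typeSpace := fun v hv => hv.1.1
  have hDm : MeasurableSet (below q \ below p) := (measurableSet_below q).diff (measurableSet_below p)
  have hfin : volume (below q \ below p) ≠ ⊤ :=
    ((measure_mono hD).trans_lt isCompact_typeSpace.measure_lt_top).ne
  have e := setIntegral_sdiff (measurableSet_below p)
    (integrableOn_massDensity (below_subset_typeSpace q)) hsub
  -- The two curves cross at `(2/5, 2/5)`. The open square `(p/2, b)²` lies below both curves and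
  -- between the two lines, so the added region has positive area.
  set b : ℝ := min (q / 2) (2 / 5) with hb
  have hb1 : p / 2 < b := lt_min (by linarith) (by linarith)
  have hb2 : b ≤ q / 2 := min_le_left _ _
  have hb3 : b ≤ 2 / 5 := min_le_right _ _
  have hbox : Ioo (p / 2) b ×ˢ Ioo (p / 2) b ⊆ below q \ below p := by
    rintro ⟨x, y⟩ ⟨⟨hx1, hx2⟩, hy1, hy2⟩
    simp only at hx1 hx2 hy1 hy2
    have h1 : ∀ t ≤ (2 / 5 : ℝ), 2 / 5 ≤ bdry t := fun t ht => by
      rw [le_bdry_iff (by linarith)]; linarith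
    have h2 := h1 x (by linarith)
    have h3 := h1 y (by linarith)
    refine ⟨⟨⟨⟨?_, ?_⟩, ?_, ?_⟩, ⟨?_, ?_⟩, ⟨?_, ?_⟩, ?_⟩, fun hv => ?_⟩
    any_goals simp only; linarith
    have := hv.2.2.2
    simp only at this
    linarith
  have hpos : 0 < volume (below q \ below p) :=
    ((isOpen_Ioo.prod isOpen_Ioo).measure_pos volume
      ((nonempty_Ioo.2 hb1).prod (nonempty_Ioo.2 hb1))).trans_le (measure_mono hbox)
  have hneg : ∫ v in below q \ below p, massDensity v ≤ ∫ v in below q \ below p, (-4 / 3 : ℝ) :=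
    setIntegral_mono_on (integrableOn_massDensity hD) (integrableOn_const hfin) hDm
      fun v hv => massDensity_le_of_below hv.1
  rw [setIntegral_const, smul_eq_mul] at hneg
  have := ENNReal.toReal_pos hpos.ne' hfin
  rw [Measure.real] at hneg
  linarith

lemma fderiv_jointDensity (v : ℝ × ℝ) :
    fderiv ℝ jointDensity v v + 3 * jointDensity v = -massDensity v := by
  have h1 : HasFDerivAt (fun v : ℝ × ℝ => 2 * (1 - v.1))
      ((2 : ℝ) • (-ContinuousLinearMap.fst ℝ ℝ ℝ)) v :=
    (hasFDerivAt_fst.const_sub 1).const_mul 2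
  have h2 : HasFDerivAt (fun v : ℝ × ℝ => 2 * (1 - v.2))
      ((2 : ℝ) • (-ContinuousLinearMap.snd ℝ ℝ ℝ)) v :=
    (hasFDerivAt_snd.const_sub 1).const_mul 2
  have h : HasFDerivAt jointDensity _ v := h1.mul h2
  rw [h.fderiv]
  simp [jointDensity, itemDensity, massDensity]
  ring

/-- The transformed measure of `jointDensity` for sets containing the origin. -/
lemma transformedMeasure_eq {S : Set (ℝ × ℝ)} (hS : MeasurableSet S) (hSX : S ⊆ typeSpace)
    (h0 : (0, 0) ∈ S) :
    transformedMeasure jointDensity S = (∫ v in S, massDensity v) + 1 := by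
  have e1 : ∀ y, S.indicator jointDensity (1, y) = 0 := fun y =>
    indicator_apply_eq_zero.2 fun _ => by simp [jointDensity, itemDensity]
  have e2 : ∀ x, S.indicator jointDensity (x, 1) = 0 := fun x =>
    indicator_apply_eq_zero.2 fun _ => by simp [jointDensity, itemDensity]
  unfold transformedMeasure
  simp only [e1, e2, fderiv_jointDensity, indicator_of_mem h0, integral_zero]
  rw [setIntegral_indicator hS, inter_eq_self_of_subset_right hSX, integral_neg]
  ring

lemma zero_mem_below {p : ℝ} (hp : 0 < p) : ((0 : ℝ), (0 : ℝ)) ∈ below p := by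
  have : 0 ≤ bdry 0 := bdry_nonneg (by norm_num)
  refine ⟨⟨⟨le_rfl, zero_le_one⟩, ⟨le_rfl, zero_le_one⟩⟩, ⟨by norm_num, this⟩, ⟨by norm_num, this⟩, ?_⟩
  simpa using hp.le

lemma transformedMeasure_below {p : ℝ} (hp : 0 < p) :
    transformedMeasure jointDensity (below p) = (∫ v in below p, massDensity v) + 1 :=
  transformedMeasure_eq (measurableSet_below p) (below_subset_typeSpace p) (zero_mem_below hp)

lemma IsCritical.transformedMeasure_eq_zero {p c : ℝ} (h : IsCritical p c) :
    transformedMeasure jointDensity (below p) = 0 := by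
  rw [transformedMeasure_below (by linarith [h.lo, h.lt_sub]), integral_massDensity_below h]
  norm_num

lemma IsCritical.eq_of_transformedMeasure_eq_zero {p c q : ℝ} (h : IsCritical p c) (hq : 0 < q)
    (hq0 : transformedMeasure jointDensity (below q) = 0) : q = p := by
  rw [transformedMeasure_below hq] at hq0
  have hp := integral_massDensity_below h
  have h1 := h.hi
  have h2 := h.lo
  have h3 := h.lt_sub
  have h4 := h.sub_lt
  rcases lt_trichotomy q p with hlt | heq | hlt
  · linarith [integral_massDensity_below_lt hq hlt (by linarith)]
  · exact heq
  · linarith [integral_massDensity_below_lt (by linarith) hlt (by linarith)]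

/-! ### One-dimensional comparison on columns -/

/-- Against a linear weight that changes sign at most once, from negative to nonnegative, a monotone
function is worth at least one of its values times the total weight. -/
lemma exists_mul_integral_le {a m k : ℝ} (ha : a ≤ 1) (h1 : 0 ≤ m + k) {χ : ℝ → ℝ}
    (hχ : MonotoneOn χ (Icc a 1)) :
    ∃ b ∈ Icc a 1, χ b * ∫ y in Icc a 1, (m * y + k) ≤ ∫ y in Icc a 1, (m * y + k) * χ y := by
  have hχi : IntegrableOn χ (Icc a 1) := hχ.integrableOn_isCompact isCompact_Icc
  have hw : Continuous fun y : ℝ => m * y + k := by fun_prop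
  -- If the weight changes sign at `b`, then `(weight at y) * (χ y - χ b) ≥ 0` pointwise. Below, `b`
  -- is `a` when the weight starts nonnegative, and otherwise its zero `-k / m`.
  have hsuff : ∀ b ∈ Icc a 1, (∀ y ∈ Icc a 1, y < b → m * y + k ≤ 0) →
      (∀ y ∈ Icc a 1, b < y → 0 ≤ m * y + k) →
      χ b * ∫ y in Icc a 1, (m * y + k) ≤ ∫ y in Icc a 1, (m * y + k) * χ y := by
    intro b hb hlt hgt
    rw [← integral_const_mul]
    refine setIntegral_mono_on ((hw.const_mul _).continuousOn.integrableOn_compact isCompact_Icc)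
      (hχi.continuousOn_mul hw.continuousOn isCompact_Icc) measurableSet_Icc fun y hy => ?_
    rcases lt_trichotomy y b with hyb | rfl | hyb
    · nlinarith [hlt y hy hyb, hχ hy hb hyb.le]
    · rw [mul_comm]
    · nlinarith [hgt y hy hyb, hχ hb hy hyb.le]
  rcases le_or_gt 0 (m * a + k) with h | h
  · refine ⟨a, ⟨le_rfl, ha⟩, hsuff a ⟨le_rfl, ha⟩ (fun y hy hya => absurd hy.1 hya.not_ge)
      fun y hy _ => ?_⟩
    rcases le_or_gt 0 m with hm | hm
    · nlinarith [hy.1]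
    · nlinarith [hy.2]
  · have hm : 0 < m := by nlinarith
    have hb : m * (-k / m) + k = 0 := by field_simp; ring
    have hbI : -k / m ∈ Icc a 1 := by
      constructor
      · rw [le_div_iff₀ hm]; linarith
      · rw [div_le_iff₀ hm]; linarith
    exact ⟨_, hbI, hsuff _ hbI (fun y _ hy => by nlinarith) fun y _ hy => by nlinarith⟩

/-- On a column the density is linear in `y` and equals `4(1 - x) ≥ 0` at `y = 1`, so it has the
required sign pattern. -/
lemma exists_mul_column_le {a x : ℝ} (ha : a ≤ 1) (hx : x ≤ 1) {χ : ℝ → ℝ}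
    (hχ : MonotoneOn χ (Icc a 1)) :
    ∃ b ∈ Icc a 1, χ b * (2 * (1 - a) * ((4 - 5 * x) * a + 3 * x - 2)) ≤
      ∫ y in Icc a 1, massDensity (x, y) * χ y := by
  obtain ⟨b, hb, h⟩ := exists_mul_integral_le (m := 4 * (4 - 5 * x)) (k := 4 * (4 * x - 3)) ha
    (by linarith) hχ
  have e : ∀ y, 4 * (4 - 5 * x) * y + 4 * (4 * x - 3) = massDensity (x, y) := fun y => by
    simp only [massDensity]; ring
  simp only [e] at h
  rw [integral_massDensity_column x ha] at h
  exact ⟨b, hb, h⟩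

lemma column_nonneg {a x : ℝ} (ha : a ≤ 1) (hx : x ≤ 1) {χ : ℝ → ℝ}
    (hχ : MonotoneOn χ (Icc a 1)) (h0 : ∀ y ∈ Icc a 1, 0 ≤ χ y)
    (hmass : 2 - 3 * x ≤ (4 - 5 * x) * a) :
    0 ≤ ∫ y in Icc a 1, massDensity (x, y) * χ y := by
  obtain ⟨b, hb, h⟩ := exists_mul_column_le ha hx hχ
  refine le_trans (mul_nonneg (h0 b hb) (mul_nonneg ?_ ?_)) h <;> linarith

lemma column_nonpos {a x : ℝ} (ha : a ≤ 1) (hx : x ≤ 1) {χ : ℝ → ℝ}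
    (hχ : AntitoneOn χ (Icc a 1)) (h0 : ∀ y ∈ Icc a 1, 0 ≤ χ y)
    (hmass : (4 - 5 * x) * a ≤ 2 - 3 * x) :
    ∫ y in Icc a 1, massDensity (x, y) * χ y ≤ 0 := by
  obtain ⟨b, hb, h⟩ := exists_mul_column_le ha hx hχ.neg
  simp only [mul_neg, integral_neg] at h
  have := mul_nonneg (h0 b hb) (mul_nonneg (show 0 ≤ 2 * (1 - a) by linarith)
    (show 0 ≤ 2 - 3 * x - (4 - 5 * x) * a by linarith))
  linarith

/-- The column mass above the curve is zero, so no sign condition on `χ` is needed. -/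
lemma column_nonneg_bdry {x : ℝ} (hx0 : 0 ≤ x) (hx : x ≤ 2 / 3) {χ : ℝ → ℝ}
    (hχ : MonotoneOn χ (Icc (bdry x) 1)) :
    0 ≤ ∫ y in Icc (bdry x) 1, massDensity (x, y) * χ y := by
  obtain ⟨b, hb, h⟩ := exists_mul_column_le (by linarith [bdry_le_half hx0 hx]) (by linarith) hχ
  have := mul_bdry hx
  rwa [show (4 - 5 * x) * bdry x + 3 * x - 2 = 0 by linarith, mul_zero, mul_zero] at h

/-! ### Integrals over regions with comparable columns and rows -/

lemma setIntegral_nonneg_of_columns {F : ℝ × ℝ → ℝ} {S : Set (ℝ × ℝ)} (hS : MeasurableSet S)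
    (hSX : S ⊆ typeSpace) (hF : IntegrableOn F typeSpace)
    (h : ∀ x ∈ Icc (0 : ℝ) 1, 0 ≤ ∫ y in {y | (x, y) ∈ S}, F (x, y)) : 0 ≤ ∫ v in S, F v := by
  rw [setIntegral_eq_columns hS hSX hF]
  exact setIntegral_nonneg measurableSet_Icc h

lemma setIntegral_nonneg_of_rows {F : ℝ × ℝ → ℝ} {S : Set (ℝ × ℝ)} (hS : MeasurableSet S)
    (hSX : S ⊆ typeSpace) (hF : IntegrableOn F typeSpace)
    (h : ∀ y ∈ Icc (0 : ℝ) 1, 0 ≤ ∫ x in {x | (x, y) ∈ S}, F (x, y)) : 0 ≤ ∫ v in S, F v := by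
  rw [setIntegral_eq_rows hS hSX hF]
  exact setIntegral_nonneg measurableSet_Icc h

lemma setIntegral_nonpos_of_columns {F : ℝ × ℝ → ℝ} {S : Set (ℝ × ℝ)} (hS : MeasurableSet S)
    (hSX : S ⊆ typeSpace) (hF : IntegrableOn F typeSpace)
    (h : ∀ x ∈ Icc (0 : ℝ) 1, ∫ y in {y | (x, y) ∈ S}, F (x, y) ≤ 0) : ∫ v in S, F v ≤ 0 := by
  rw [setIntegral_eq_columns hS hSX hF]
  exact setIntegral_nonpos measurableSet_Icc h

lemma setIntegral_nonpos_of_rows {F : ℝ × ℝ → ℝ} {S : Set (ℝ × ℝ)} (hS : MeasurableSet S)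
    (hSX : S ⊆ typeSpace) (hF : IntegrableOn F typeSpace)
    (h : ∀ y ∈ Icc (0 : ℝ) 1, ∫ x in {x | (x, y) ∈ S}, F (x, y) ≤ 0) : ∫ v in S, F v ≤ 0 := by
  rw [setIntegral_eq_rows hS hSX hF]
  exact setIntegral_nonpos measurableSet_Icc h

lemma massDensity_mk_comm (x y : ℝ) : massDensity (x, y) = massDensity (y, x) :=
  massDensity_swap (y, x)

section

variable {p c : ℝ}

/-! ### The region `𝒲` -/

lemma slice_regionW_of_le (h : IsCritical p c) {x : ℝ} (h1 : c ≤ x) (h2 : x ≤ p - c) :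
    {y | (x, y) ∈ regionW p c} = Icc (p - x) 1 := by
  have := h.sub_lt
  rw [slice_regionW, if_pos ⟨h1, by linarith⟩, max_eq_right (by linarith)]

lemma isClosed_regionW : IsClosed (regionW p c) :=
  (isClosed_Icc.preimage continuous_fst).inter ((isClosed_Icc.preimage continuous_snd).inter
    (isClosed_le continuous_const (continuous_fst.add continuous_snd)))

/-- A nonnegative function on `𝒲` which decreases in each coordinate and vanishes above a point
lying weakly below both curves has nonpositive integral. -/
lemma integral_regionW_nonpos (h : IsCritical p c) {ψ : ℝ × ℝ → ℝ}
    (hψ : ContinuousOn ψ typeSpace) (hanti : AntitoneOn ψ (regionW p c))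
    (h0 : ∀ v ∈ regionW p c, 0 ≤ ψ v) {z : ℝ × ℝ} (hz : z ∈ regionW p c)
    (hz1 : z.1 ≤ 2 / 3 ∧ z.2 ≤ bdry z.1) (hz2 : z.2 ≤ 2 / 3 ∧ z.1 ≤ bdry z.2)
    (hzero : ψ z = 0) :
    ∫ v in regionW p c, massDensity v * ψ v ≤ 0 := by
  have hc := h.hi
  have hc0 := h.lo
  have hpc := h.sub_lt
  have hpc' := h.lt_sub
  obtain ⟨a, b⟩ := z
  simp only at hz1 hz2
  have haI := hz.1
  have hbI := hz.2.1
  have hab := hz.2.2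
  simp only at haI hbI hab
  have ha : a ≤ p - c := by
    rw [← h.bdry_c]
    exact hz2.2.trans (bdry_anti hbI.1 hz2.1)
  have hb : b ≤ p - c := by
    rw [← h.bdry_c]
    exact hz1.2.trans (bdry_anti haI.1 hz1.1)
  have hint : IntegrableOn (fun v => massDensity v * ψ v) typeSpace :=
    (continuous_massDensity.continuousOn.mul hψ).integrableOn_compact isCompact_typeSpace
  have hvanish : ∀ v ∈ regionW p c, a ≤ v.1 → b ≤ v.2 → ψ v = 0 := fun v hv h1 h2 =>
    le_antisymm (hzero ▸ hanti hz hv ⟨h1, h2⟩) (h0 v hv)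
  have hm1 : MeasurableSet {v : ℝ × ℝ | v.1 < a} := measurableSet_lt measurable_fst measurable_const
  have hW := measurableSet_regionW (p := p) (c := c)
  have hWX := regionW_subset h
  -- Left of `z` use columns; right of `z` and below it use rows; the remaining quadrant above `z`
  -- contributes nothing. Each slice starts weakly below its curve and so has nonpositive mass.
  rw [← integral_inter_add_sdiff hm1 (hint.mono_set hWX)]
  refine add_nonpos ?_ ?_
  · refine setIntegral_nonpos_of_columns (hW.inter hm1) (inter_subset_left.trans hWX) hint
      fun x hx => ?_
    by_cases hxa : c ≤ x ∧ x < a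
    · have e : {y | (x, y) ∈ regionW p c ∩ {v | v.1 < a}} = Icc (p - x) 1 := by
        rw [← slice_regionW_of_le h hxa.1 (by linarith)]
        ext y
        exact ⟨fun hy => hy.1, fun hy => ⟨hy, hxa.2⟩⟩
      have hmem : ∀ y ∈ Icc (p - x) 1, (x, y) ∈ regionW p c := fun y hy => by
        rw [← slice_regionW_of_le h hxa.1 (by linarith)] at hy
        exact hy
      rw [e]
      refine column_nonpos (by linarith) hx.2
        (fun y hy y' hy' hyy => hanti (hmem y hy) (hmem y' hy') ⟨le_rfl, hyy⟩)
        (fun y hy => h0 _ (hmem y hy)) ?_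
      exact (le_bdry_iff (by linarith)).1 (h.line_le_bdry hxa.1 (by linarith))
    · have e : {y | (x, y) ∈ regionW p c ∩ {v | v.1 < a}} = ∅ :=
        eq_empty_of_forall_notMem fun y hy => hxa ⟨hy.1.1.1, hy.2⟩
      rw [e, setIntegral_empty]
  · refine setIntegral_nonpos_of_rows (hW.diff hm1) (sdiff_subset.trans hWX) hint
      fun y hy => ?_
    by_cases hyc : c ≤ y ∧ y < b
    · have e : {x | (x, y) ∈ regionW p c \ {v | v.1 < a}} = Icc (max a (p - y)) 1 := by
        ext x
        constructor
        · rintro ⟨⟨h1, _, h3⟩, h4⟩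
          exact ⟨max_le (not_lt.1 h4) (by simp only at h3; linarith), h1.2⟩
        · rintro ⟨h1, h2⟩
          have h3 := (le_max_left _ _).trans h1
          have h4 := (le_max_right _ _).trans h1
          exact ⟨⟨⟨haI.1.trans h3, h2⟩, ⟨hyc.1, hy.2⟩, by simp only; linarith⟩, not_lt.2 h3⟩
      have hmem : ∀ x ∈ Icc (max a (p - y)) 1, (x, y) ∈ regionW p c := fun x hx => by
        rw [← e] at hx
        exact hx.1
      rw [e]
      simp only [massDensity_mk_comm _ y]
      refine column_nonpos (χ := fun x => ψ (x, y)) (max_le (by linarith) (by linarith)) hy.2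
        (fun x hx x' hx' hxx => hanti (hmem x hx) (hmem x' hx') ⟨hxx, le_rfl⟩)
        (fun x hx => h0 _ (hmem x hx)) ?_
      refine (le_bdry_iff (by linarith)).1 (max_le ?_ (h.line_le_bdry hyc.1 (by linarith)))
      exact hz2.2.trans (bdry_anti hyc.2.le hz2.1)
    · refine (setIntegral_eq_zero_of_forall_eq_zero fun x hx => ?_).le
      have h1 : c ≤ y := hx.1.2.1.1
      have h2 : b ≤ y := not_lt.1 fun hlt => hyc ⟨h1, hlt⟩
      rw [hvanish _ hx.1 (not_lt.1 hx.2) h2, mul_zero]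

/-- A nonnegative function on `𝒲` which increases in each coordinate and vanishes weakly below both
curves has nonnegative integral. -/
lemma integral_regionW_nonneg (h : IsCritical p c) {χ : ℝ × ℝ → ℝ}
    (hχ : ContinuousOn χ typeSpace) (hmono : MonotoneOn χ (regionW p c))
    (h0 : ∀ v ∈ regionW p c, 0 ≤ χ v)
    (hzero : ∀ v ∈ regionW p c, v.1 ≤ 2 / 3 ∧ v.2 ≤ bdry v.1 → v.2 ≤ 2 / 3 ∧ v.1 ≤ bdry v.2 →
      χ v = 0) :
    0 ≤ ∫ v in regionW p c, massDensity v * χ v := by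
  have hc := h.hi
  have hc0 := h.lo
  have hpc := h.sub_lt
  have hpc' := h.lt_sub
  have hint : IntegrableOn (fun v => massDensity v * χ v) typeSpace :=
    (continuous_massDensity.continuousOn.mul hχ).integrableOn_compact isCompact_typeSpace
  -- The cuts pass through the crossing point `(2/5, 2/5)` of the curves. Columns left of it and
  -- rows below it reduce to zero-mass slices above a curve, since `χ` vanishes underneath.
  have hm1 : MeasurableSet {v : ℝ × ℝ | v.1 < 2 / 5} :=
    measurableSet_lt measurable_fst measurable_const
  have hm2 : MeasurableSet {v : ℝ × ℝ | v.2 < 2 / 5} :=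
    measurableSet_lt measurable_snd measurable_const
  have hW := measurableSet_regionW (p := p) (c := c)
  have hWX := regionW_subset h
  have hlow : ∀ t ≤ (2 / 5 : ℝ), 2 / 5 ≤ bdry t := fun t ht => by
    rw [le_bdry_iff (by linarith)]; linarith
  -- below the lower of the two curves one is also below the other one
  have hcross : ∀ x y : ℝ, 0 ≤ x → x ≤ 2 / 5 → y ≤ bdry x → y ≤ 2 / 3 ∧ x ≤ bdry y := by
    intro x y hx0 hx hy
    have h1 : y ≤ 1 / 2 := hy.trans (bdry_le_half hx0 (by linarith))
    refine ⟨by linarith, ?_⟩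
    rw [le_bdry_iff (by linarith)] at hy ⊢
    nlinarith
  rw [← integral_inter_add_sdiff hm1 (hint.mono_set hWX),
    ← integral_inter_add_sdiff hm2 (hint.mono_set (sdiff_subset.trans hWX))]
  refine add_nonneg ?_ (add_nonneg ?_ ?_)
  · refine setIntegral_nonneg_of_columns (hW.inter hm1) (inter_subset_left.trans hWX) hint
      fun x hx => ?_
    by_cases hxa : c ≤ x ∧ x < 2 / 5
    · have e : {y | (x, y) ∈ regionW p c ∩ {v | v.1 < 2 / 5}} = Icc (p - x) 1 := by
        rw [← slice_regionW_of_le h hxa.1 (by linarith)]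
        ext y
        exact ⟨fun hy => hy.1, fun hy => ⟨hy, hxa.2⟩⟩
      have hmem : ∀ y ∈ Icc (p - x) 1, (x, y) ∈ regionW p c := fun y hy => by
        rw [← slice_regionW_of_le h hxa.1 (by linarith)] at hy
        exact hy
      have hle := h.line_le_bdry hxa.1 (by linarith)
      have hsub : Icc (bdry x) 1 ⊆ Icc (p - x) 1 := Icc_subset_Icc_left hle
      rw [e, setIntegral_eq_of_subset_of_forall_sdiff_eq_zero measurableSet_Icc hsub]
      · exact column_nonneg_bdry hx.1 (by linarith)
          fun y hy y' hy' hyy => hmono (hmem y (hsub hy)) (hmem y' (hsub hy')) ⟨le_rfl, hyy⟩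
      · intro y hy
        have h1 : y ≤ bdry x := le_of_not_ge fun hle => hy.2 ⟨hle, hy.1.2⟩
        rw [hzero _ (hmem y hy.1) ⟨by simp only; linarith, h1⟩ (hcross x y hx.1 hxa.2.le h1),
          mul_zero]
    · have e : {y | (x, y) ∈ regionW p c ∩ {v | v.1 < 2 / 5}} = ∅ :=
        eq_empty_of_forall_notMem fun y hy => hxa ⟨hy.1.1.1, hy.2⟩
      rw [e, setIntegral_empty]
  · refine setIntegral_nonneg_of_rows ((hW.diff hm1).inter hm2)
      ((inter_subset_left.trans sdiff_subset).trans hWX) hint fun y hy => ?_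
    by_cases hyc : c ≤ y ∧ y < 2 / 5
    · have hle := h.line_le_bdry hyc.1 (by linarith)
      have h25 := hlow y hyc.2.le
      have e : {x | (x, y) ∈ (regionW p c \ {v | v.1 < 2 / 5}) ∩ {v | v.2 < 2 / 5}} =
          Icc (max (2 / 5) (p - y)) 1 := by
        ext x
        constructor
        · rintro ⟨⟨⟨h1, _, h3⟩, h4⟩, _⟩
          exact ⟨max_le (not_lt.1 h4) (by simp only at h3; linarith), h1.2⟩
        · rintro ⟨h1, h2⟩
          have h3 := (le_max_left _ _).trans h1
          have h4 := (le_max_right _ _).trans h1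
          exact ⟨⟨⟨⟨by linarith, h2⟩, ⟨hyc.1, hy.2⟩, by simp only; linarith⟩, not_lt.2 h3⟩, hyc.2⟩
      have hmem : ∀ x ∈ Icc (max (2 / 5) (p - y)) 1, (x, y) ∈ regionW p c := fun x hx => by
        rw [← e] at hx
        exact hx.1.1
      have hsub : Icc (bdry y) 1 ⊆ Icc (max (2 / 5) (p - y)) 1 :=
        Icc_subset_Icc_left (max_le h25 hle)
      rw [e, setIntegral_eq_of_subset_of_forall_sdiff_eq_zero measurableSet_Icc hsub]
      swap
      · intro x hx
        have h1 : x ≤ bdry y := le_of_not_ge fun hle => hx.2 ⟨hle, hx.1.2⟩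
        have h2 : y ≤ 2 / 3 ∧ x ≤ bdry y := ⟨by linarith, h1⟩
        rw [hzero _ (hmem x hx.1) (hcross y x hy.1 hyc.2.le h1) h2, mul_zero]
      simp only [massDensity_mk_comm _ y]
      exact column_nonneg_bdry (χ := fun x => χ (x, y)) hy.1 (by linarith)
        fun x hx x' hx' hxx => hmono (hmem x (hsub hx)) (hmem x' (hsub hx')) ⟨hxx, le_rfl⟩
    · have e : {x | (x, y) ∈ (regionW p c \ {v | v.1 < 2 / 5}) ∩ {v | v.2 < 2 / 5}} = ∅ :=
        eq_empty_of_forall_notMem fun x hx => hyc ⟨hx.1.1.2.1.1, hx.2⟩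
      rw [e, setIntegral_empty]
  · refine setIntegral_nonneg_of_columns ((hW.diff hm1).diff hm2)
      ((sdiff_subset.trans sdiff_subset).trans hWX) hint fun x hx => ?_
    by_cases hxa : 2 / 5 ≤ x
    · have e : {y | (x, y) ∈ (regionW p c \ {v | v.1 < 2 / 5}) \ {v | v.2 < 2 / 5}} =
          Icc (2 / 5) 1 := by
        ext y
        constructor
        · rintro ⟨⟨⟨_, h1, _⟩, _⟩, h2⟩
          exact ⟨not_lt.1 h2, h1.2⟩
        · rintro ⟨h1, h2⟩
          exact ⟨⟨⟨⟨by linarith, hx.2⟩, ⟨by linarith, h2⟩, by simp only; linarith⟩, not_lt.2 hxa⟩,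
            not_lt.2 h1⟩
      have hmem : ∀ y ∈ Icc (2 / 5) 1, (x, y) ∈ regionW p c := fun y hy => by
        rw [← e] at hy
        exact hy.1.1
      rw [e]
      -- A column starting at height `2/5` has mass a nonnegative multiple of `x - 2/5`.
      exact column_nonneg (by norm_num) hx.2
        (fun y hy y' hy' hyy => hmono (hmem y hy) (hmem y' hy') ⟨le_rfl, hyy⟩)
        (fun y hy => h0 _ (hmem y hy)) (by linarith)
    · have e : {y | (x, y) ∈ (regionW p c \ {v | v.1 < 2 / 5}) \ {v | v.2 < 2 / 5}} = ∅ :=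
        eq_empty_of_forall_notMem fun y hy => hxa (not_lt.1 hy.1.2)
      rw [e, setIntegral_empty]

/-- The integral over `𝒲` of a function which increases in each coordinate is nonnegative: on `𝒲`
the positive part of the transformed measure dominates the negative part to the first order. -/
lemma integral_regionW_monotone_nonneg (h : IsCritical p c) {φ : ℝ × ℝ → ℝ}
    (hφ : ContinuousOn φ typeSpace) (hmono : MonotoneOn φ (regionW p c)) :
    0 ≤ ∫ v in regionW p c, massDensity v * φ v := by
  have hc := h.hi
  have hc0 := h.lo
  have hpc := h.sub_lt
  have hpc' := h.lt_sub
  -- On the square `x + y ≤ 2` always holds, so `below 2` is the full region under both curves.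
  have hR : IsCompact (below 2 ∩ regionW p c) :=
    isCompact_typeSpace.of_isClosed_subset ((isClosed_below 2).inter isClosed_regionW)
      fun v hv => hv.1.1
  have hne : (c, p - c) ∈ below 2 ∩ regionW p c := by
    have hmem := (isLeast_fst h).1
    refine ⟨⟨hmem.1, hmem.2.1, hmem.2.2.1, by simp only; linarith⟩, ⟨le_rfl, by linarith⟩,
      ⟨by simp only; linarith, by simp only; linarith⟩, by simp⟩
  obtain ⟨z, hz, hmax⟩ := hR.exists_isMaxOn ⟨_, hne⟩ (hφ.mono fun v hv => hv.1.1)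
  have hψ : ContinuousOn (fun v => max (φ z - φ v) 0) typeSpace :=
    (continuousOn_const.sub hφ).sup continuousOn_const
  have hχ : ContinuousOn (fun v => max (φ v - φ z) 0) typeSpace :=
    (hφ.sub continuousOn_const).sup continuousOn_const
  have h1 := integral_regionW_nonpos h hψ
    (fun v hv w hw hvw => max_le_max_right _ (by linarith [hmono hv hw hvw]))
    (fun v _ => le_max_right _ _) hz.2 hz.1.2.1 hz.1.2.2.1 (by simp)
  have h2 := integral_regionW_nonneg h hχ
    (fun v hv w hw hvw => max_le_max_right _ (by linarith [hmono hv hw hvw]))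
    (fun v _ => le_max_right _ _) fun v hv hv1 hv2 => max_eq_right (sub_nonpos.2 (hmax
      ⟨⟨regionW_subset h hv, hv1, hv2, by linarith [hv.1.2, hv.2.1.2]⟩, hv⟩))
  have hint : ∀ {χ : ℝ × ℝ → ℝ}, ContinuousOn χ typeSpace →
      IntegrableOn (fun v => massDensity v * χ v) (regionW p c) := fun hχ =>
    ((continuous_massDensity.continuousOn.mul hχ).integrableOn_compact
      isCompact_typeSpace).mono_set (regionW_subset h)
  -- The constant `φ z` contributes nothing because `𝒲` has mass zero.
  have e : ∀ v, massDensity v * φ v = massDensity v * max (φ v - φ z) 0 -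
      massDensity v * max (φ z - φ v) 0 + massDensity v * φ z := by
    intro v
    rcases le_total (φ v) (φ z) with hle | hle
    · rw [max_eq_right (sub_nonpos.2 hle), max_eq_left (sub_nonneg.2 hle)]; ring
    · rw [max_eq_left (sub_nonneg.2 hle), max_eq_right (sub_nonpos.2 hle)]; ring
  simp only [e]
  have i12 : IntegrableOn (fun v => massDensity v * max (φ v - φ z) 0 -
      massDensity v * max (φ z - φ v) 0) (regionW p c) := (hint hχ).sub (hint hψ)
  rw [integral_add i12 (hint continuousOn_const), integral_sub (hint hχ) (hint hψ),
    integral_mul_const, integral_massDensity_regionW h]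
  linarith

end

section

variable {p c : ℝ}

/-! ### The optimal mechanism -/

lemma slope_mem_Icc {t : ℝ} (ht : t ≤ 0.06189) : 2 / (4 - 5 * t) ^ 2 ∈ Icc (0 : ℝ) (1 / 5) := by
  refine ⟨by positivity, ?_⟩
  have : (0 : ℝ) < (4 - 5 * t) ^ 2 := by nlinarith
  rw [div_le_iff₀ this]
  nlinarith

open Classical in
/-- The mechanism with the outcomes prescribed on the four regions. -/
noncomputable def optimalMechanism (h : IsCritical p c) : Mechanism where
  alloc v := if v ∈ regionA c then (2 / (4 - 5 * v.1) ^ 2, 1) else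
    if v ∈ regionB c then (1, 2 / (4 - 5 * v.2) ^ 2) else if v ∈ regionW p c then (1, 1) else (0, 0)
  price v := if v ∈ regionA c then bdry v.1 + 2 * v.1 / (4 - 5 * v.1) ^ 2 else
    if v ∈ regionB c then bdry v.2 + 2 * v.2 / (4 - 5 * v.2) ^ 2 else
      if v ∈ regionW p c then p else 0
  alloc_mem := by
    have h01 : ∀ t < c, 2 / (4 - 5 * t) ^ 2 ∈ Icc (0 : ℝ) 1 := fun t ht =>
      Icc_subset_Icc_right (by norm_num) (slope_mem_Icc (ht.le.trans h.hi))
    intro v _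
    split_ifs with hA hB hW
    · exact ⟨h01 _ hA.1.2, by simp⟩
    · exact ⟨by simp, h01 _ hB.1.2⟩
    all_goals simp

lemma outcome_of_mem_regionA (h : IsCritical p c) {v : ℝ × ℝ} (hv : v ∈ regionA c) :
    (optimalMechanism h).alloc v = (2 / (4 - 5 * v.1) ^ 2, 1) ∧
      (optimalMechanism h).price v = bdry v.1 + 2 * v.1 / (4 - 5 * v.1) ^ 2 := by
  simp [optimalMechanism, hv]

lemma outcome_of_mem_regionB (h : IsCritical p c) {v : ℝ × ℝ} (hv : v ∈ regionB c) :
    (optimalMechanism h).alloc v = (1, 2 / (4 - 5 * v.2) ^ 2) ∧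
      (optimalMechanism h).price v = bdry v.2 + 2 * v.2 / (4 - 5 * v.2) ^ 2 := by
  simp [optimalMechanism, hv, (disjoint_regionA_regionB h).notMem_of_mem_right hv]

lemma outcome_of_mem_regionW (h : IsCritical p c) {v : ℝ × ℝ} (hv : v ∈ regionW p c) :
    (optimalMechanism h).alloc v = (1, 1) ∧ (optimalMechanism h).price v = p := by
  simp [optimalMechanism, hv, disjoint_regionA_regionW.notMem_of_mem_right hv,
    disjoint_regionB_regionW.notMem_of_mem_right hv]

lemma outcome_of_mem_regionZ (h : IsCritical p c) {v : ℝ × ℝ} (hv : v ∈ regionZ p c) :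
    (optimalMechanism h).alloc v = (0, 0) ∧ (optimalMechanism h).price v = 0 := by
  have hA : v ∉ regionA c := fun hA => hv.2 (.inl (.inr hA))
  have hB : v ∉ regionB c := fun hB => hv.2 (.inr hB)
  have hW : v ∉ regionW p c := fun hW => hv.2 (.inl (.inl hW))
  simp [optimalMechanism, hA, hB, hW]

/-- A menu entry of `𝒜` pays the height of the type above the tangent to the curve at `w.1`. By
concavity the best tangent is the one at the type's own abscissa. -/
lemma utility_of_mem_regionA (h : IsCritical p c) (v : ℝ × ℝ) {w : ℝ × ℝ} (hw : w ∈ regionA c) :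
    (optimalMechanism h).utility v w =
      v.2 - (bdry w.1 - 2 / (4 - 5 * w.1) ^ 2 * (v.1 - w.1)) := by
  obtain ⟨h1, h2⟩ := outcome_of_mem_regionA h hw
  rw [Mechanism.utility, h1, h2]
  ring

lemma utility_of_mem_regionB (h : IsCritical p c) (v : ℝ × ℝ) {w : ℝ × ℝ} (hw : w ∈ regionB c) :
    (optimalMechanism h).utility v w =
      v.1 - (bdry w.2 - 2 / (4 - 5 * w.2) ^ 2 * (v.2 - w.2)) := by
  obtain ⟨h1, h2⟩ := outcome_of_mem_regionB h hw
  rw [Mechanism.utility, h1, h2]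
  ring

lemma utility_of_mem_regionW (h : IsCritical p c) (v : ℝ × ℝ) {w : ℝ × ℝ} (hw : w ∈ regionW p c) :
    (optimalMechanism h).utility v w = v.1 + v.2 - p := by
  obtain ⟨h1, h2⟩ := outcome_of_mem_regionW h hw
  rw [Mechanism.utility, h1, h2]
  ring

lemma utility_of_mem_regionZ (h : IsCritical p c) (v : ℝ × ℝ) {w : ℝ × ℝ} (hw : w ∈ regionZ p c) :
    (optimalMechanism h).utility v w = 0 := by
  obtain ⟨h1, h2⟩ := outcome_of_mem_regionZ h hw
  rw [Mechanism.utility, h1, h2]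
  ring

lemma self_utility_of_mem_regionA (h : IsCritical p c) {v : ℝ × ℝ} (hv : v ∈ regionA c) :
    (optimalMechanism h).utility v v = v.2 - bdry v.1 := by
  rw [utility_of_mem_regionA h v hv]; ring

lemma self_utility_of_mem_regionB (h : IsCritical p c) {v : ℝ × ℝ} (hv : v ∈ regionB c) :
    (optimalMechanism h).utility v v = v.1 - bdry v.2 := by
  rw [utility_of_mem_regionB h v hv]; ring

/-- Bounds on the value `y - (s(t) - q (x - t))` of a menu entry of `𝒜` (tangent at `t < c`) to the
type `(x, y)`. -/
lemma tangent_value_le (h : IsCritical p c) {t x y : ℝ} (ht : t < c) :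
    (x ≤ c → y - (bdry t - 2 / (4 - 5 * t) ^ 2 * (x - t)) ≤ y - bdry x) ∧
    (c ≤ x → y - (bdry t - 2 / (4 - 5 * t) ^ 2 * (x - t)) ≤ x + y - p) := by
  have hc := h.hi
  obtain ⟨hq0, hq1⟩ := slope_mem_Icc (t := t) (by linarith)
  refine ⟨fun hx => ?_, fun hx => ?_⟩
  · linarith [bdry_le_tangent (x := x) (t := t) (by linarith) (by linarith)]
  · have h1 := bdry_le_tangent (x := c) (t := t) (by linarith) (by linarith)
    rw [h.bdry_c] at h1
    nlinarith

/-- Truthful utility dominates the four values that bound every possible deviation; with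
`tangent_value_le` this yields incentive compatibility. -/
lemma self_utility_ge (h : IsCritical p c) {v : ℝ × ℝ} (hv : v ∈ typeSpace) :
    0 ≤ (optimalMechanism h).utility v v ∧
    v.1 + v.2 - p ≤ (optimalMechanism h).utility v v ∧
    (v.1 ≤ c → v.2 - bdry v.1 ≤ (optimalMechanism h).utility v v) ∧
    (v.2 ≤ c → v.1 - bdry v.2 ≤ (optimalMechanism h).utility v v) := by
  have hc := h.hi
  have hpc := h.lt_sub
  rcases region_cases (p := p) (c := c) hv with hZ | hA | hB | hW
  · rw [utility_of_mem_regionZ h v hZ]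
    obtain ⟨_, ⟨_, h2⟩, ⟨_, h4⟩, h5⟩ := regionZ_subset_below h hZ
    exact ⟨le_rfl, by linarith, fun _ => by linarith, fun _ => by linarith⟩
  · rw [self_utility_of_mem_regionA h hA]
    have h1 := h.bdry_le_line hA.1.2.le
    have h2 := h.lt_bdry hA.1.2.le
    have h3 := hA.1.2
    have h4 := hA.2.1
    exact ⟨by linarith, by linarith, fun _ => le_rfl, fun _ => by linarith⟩
  · rw [self_utility_of_mem_regionB h hB]
    have h1 := h.bdry_le_line hB.1.2.le
    have h2 := h.lt_bdry hB.1.2.le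
    have h3 := hB.1.2
    have h4 := hB.2.1
    exact ⟨by linarith, by linarith, fun _ => by linarith, fun _ => le_rfl⟩
  · rw [utility_of_mem_regionW h v hW]
    have h1 := hW.1.1
    have h2 := hW.2.1.1
    have h3 := hW.2.2
    refine ⟨by linarith, le_rfl, fun hx => ?_, fun hx => ?_⟩
    · rw [le_antisymm hx h1, h.bdry_c]; linarith
    · rw [le_antisymm hx h2, h.bdry_c]; linarith

lemma optimalMechanism_IR (h : IsCritical p c) : (optimalMechanism h).IR :=
  fun _ hv => (self_utility_ge h hv).1

lemma optimalMechanism_IC (h : IsCritical p c) : (optimalMechanism h).IC := by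
  intro v hv w hw
  obtain ⟨h0, h1, h2, h3⟩ := self_utility_ge h hv
  rcases region_cases (p := p) (c := c) hw with hZ | hA | hB | hW
  · rwa [utility_of_mem_regionZ h v hZ]
  · rw [utility_of_mem_regionA h v hA]
    obtain ⟨t1, t2⟩ := tangent_value_le h (x := v.1) (y := v.2) hA.1.2
    rcases le_total v.1 c with hx | hx
    · exact (t1 hx).trans (h2 hx)
    · exact (t2 hx).trans h1
  · rw [utility_of_mem_regionB h v hB]
    obtain ⟨t1, t2⟩ := tangent_value_le h (x := v.2) (y := v.1) hB.1.2
    rcases le_total v.2 c with hx | hx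
    · exact (t1 hx).trans (h3 hx)
    · exact (t2 hx).trans (by linarith)
  · rwa [utility_of_mem_regionW h v hW]

/-! ### Optimality -/

namespace Mechanism

variable {N : Mechanism}

lemma IC.utility_sub_le_fst (hN : N.IC) {x x' y : ℝ} (hx : (x, y) ∈ typeSpace)
    (hx' : (x', y) ∈ typeSpace) (hxx : x ≤ x') :
    N.utility (x', y) (x', y) - N.utility (x, y) (x, y) ≤ x' - x := by
  have h1 := hN.le_utility hx hx'
  have h2 := (N.alloc_mem _ hx').1.2
  simp only [sub_self, mul_zero, add_zero] at h1
  nlinarith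

lemma IC.utility_sub_le_snd (hN : N.IC) {x y y' : ℝ} (hy : (x, y) ∈ typeSpace)
    (hy' : (x, y') ∈ typeSpace) (hyy : y ≤ y') :
    N.utility (x, y') (x, y') - N.utility (x, y) (x, y) ≤ y' - y := by
  have h1 := hN.le_utility hy hy'
  have h2 := (N.alloc_mem _ hy').2.2
  simp only [sub_self, mul_zero, zero_add] at h1
  nlinarith

lemma IC.utility_sub_le (hN : N.IC) {v w : ℝ × ℝ} (hv : v ∈ typeSpace) (hw : w ∈ typeSpace)
    (hvw : v ≤ w) :
    N.utility w w - N.utility v v ≤ w.1 + w.2 - (v.1 + v.2) := by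
  have h1 := hN.le_utility hv hw
  have h2 := (N.alloc_mem w hw).1.2
  have h3 := (N.alloc_mem w hw).2.2
  nlinarith [hvw.1, hvw.2]

end Mechanism

theorem optimalMechanism_isOptimal (h : IsCritical p c) :
    (optimalMechanism h).IsOptimal jointDensity := by
  have hIC := optimalMechanism_IC h
  refine ⟨hIC, optimalMechanism_IR h, fun N hN hN0 => ⟨hN.revenue_eq.1, ?_⟩⟩
  rw [hN.revenue_eq.2, hIC.revenue_eq.2, ← sub_nonneg]
  set D : ℝ × ℝ → ℝ := fun v => (optimalMechanism h).utility v v - N.utility v v with hD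
  have hcont : ContinuousOn D typeSpace := hIC.continuousOn.sub hN.continuousOn
  have i : ∀ {χ : ℝ × ℝ → ℝ}, ContinuousOn χ typeSpace →
      IntegrableOn (fun v => massDensity v * χ v) typeSpace := fun hχ =>
    (continuous_massDensity.continuousOn.mul hχ).integrableOn_compact isCompact_typeSpace
  rw [← integral_sub (i hIC.continuousOn) (i hN.continuousOn)]
  simp only [← mul_sub]
  change 0 ≤ ∫ v in typeSpace, massDensity v * D v
  have hint := i hcont
  have hc := h.hi
  rw [integral_eq_add_regions h hint]
  refine add_nonneg (add_nonneg (add_nonneg ?_ ?_) ?_) ?_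
  · refine setIntegral_nonneg measurableSet_regionZ fun v hv => ?_
    have h1 := massDensity_le_of_below (regionZ_subset_below h hv)
    have h2 := hN0 v hv.1
    simp only [hD, utility_of_mem_regionZ h v hv]
    nlinarith
  · refine setIntegral_nonneg_of_columns measurableSet_regionA (regionA_subset h) hint
      fun x hx => ?_
    have hs := slice_regionA (c := c) hx
    rw [hs]
    split_ifs at hs ⊢ with hxc
    · have hmem : ∀ y ∈ Icc (bdry x) 1, (x, y) ∈ regionA c := fun y hy => by
        rw [← hs] at hy; exact hy
      refine column_nonneg_bdry hx.1 (by linarith) fun y hy y' hy' hyy => ?_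
      have := hN.utility_sub_le_snd (regionA_subset h (hmem y hy))
        (regionA_subset h (hmem y' hy')) hyy
      simp only [hD, self_utility_of_mem_regionA h (hmem y hy),
        self_utility_of_mem_regionA h (hmem y' hy')]
      linarith
    · simp
  · refine setIntegral_nonneg_of_rows measurableSet_regionB (regionB_subset h) hint
      fun y hy => ?_
    have hs : {x | (x, y) ∈ regionB c} = _ := slice_regionA (c := c) hy
    rw [hs]
    simp only [massDensity_mk_comm _ y]
    split_ifs at hs ⊢ with hyc
    · have hmem : ∀ x ∈ Icc (bdry y) 1, (x, y) ∈ regionB c := fun x hx => by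
        rw [← hs] at hx; exact hx
      refine column_nonneg_bdry (χ := fun x => D (x, y)) hy.1 (by linarith)
        fun x hx x' hx' hxx => ?_
      have := hN.utility_sub_le_fst (regionB_subset h (hmem x hx))
        (regionB_subset h (hmem x' hx')) hxx
      simp only [hD, self_utility_of_mem_regionB h (hmem x hx),
        self_utility_of_mem_regionB h (hmem x' hx')]
      linarith
    · simp
  -- On `𝒲` the proposed utility rises at rate 1 in each coordinate, the fastest any IC mechanism
  -- allows, so `D` is monotone.
  · refine integral_regionW_monotone_nonneg h hcont fun v hv w hw hvw => ?_
    have := hN.utility_sub_le (regionW_subset h hv) (regionW_subset h hw) hvw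
    simp only [hD, utility_of_mem_regionW h _ hv, utility_of_mem_regionW h _ hw]
    linarith

/-! ### The size of the menu -/

lemma mk_le_continuum (S : Set ((ℝ × ℝ) × ℝ)) : Cardinal.mk S ≤ Cardinal.continuum :=
  (Cardinal.mk_set_le S).trans (by simp [Cardinal.mk_real])

lemma slope_injOn : InjOn (fun t : ℝ => 2 / (4 - 5 * t) ^ 2) (Iic (2 / 3)) := by
  intro s hs t ht hst
  have hs' : 0 < 4 - 5 * s := by linarith [mem_Iic.1 hs]
  have ht' : 0 < 4 - 5 * t := by linarith [mem_Iic.1 ht]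
  simp only at hst
  rw [div_eq_div_iff (by positivity) (by positivity)] at hst
  have : 4 - 5 * t = 4 - 5 * s :=
    (pow_left_inj₀ ht'.le hs'.le two_ne_zero).1 (mul_left_cancel₀ two_ne_zero hst)
  linarith

lemma continuum_le_of_injOn {S : Set ((ℝ × ℝ) × ℝ)} (hc : 0 < c) {f : ℝ → (ℝ × ℝ) × ℝ}
    (hf : InjOn f (Ico 0 c)) (hS : MapsTo f (Ico 0 c) S) :
    Cardinal.continuum ≤ Cardinal.mk S := by
  rw [← Cardinal.mk_Ico_real hc, ← Cardinal.mk_image_eq_of_injOn f _ hf]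
  exact Cardinal.mk_le_mk_of_subset hS.image_subset

/-- Types `(x, 1)` with `0 ≤ x < c` get distinct probabilities of item 1, since the slope of the
curve is injective. -/
lemma mk_outcome_regionA (h : IsCritical p c) :
    Cardinal.mk ((optimalMechanism h).outcome '' regionA c) = Cardinal.continuum := by
  have hmem : ∀ x ∈ Ico 0 c, (x, (1 : ℝ)) ∈ regionA c := fun x hx =>
    ⟨hx, by simp only; linarith [bdry_le_half hx.1 (by linarith [hx.2, h.hi])], le_rfl⟩
  refine (mk_le_continuum _).antisymm (continuum_le_of_injOn h.c_pos
    (f := fun x => (optimalMechanism h).outcome (x, 1)) (fun x hx y hy hxy => ?_)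
    fun x hx => mem_image_of_mem _ (hmem x hx))
  have := congrArg (fun o => o.1.1) hxy
  simp only [Mechanism.outcome, (outcome_of_mem_regionA h (hmem x hx)).1,
    (outcome_of_mem_regionA h (hmem y hy)).1] at this
  exact slope_injOn (by simp only [mem_Iic]; linarith [hx.2, h.hi])
    (by simp only [mem_Iic]; linarith [hy.2, h.hi]) this

lemma mk_outcome_regionB (h : IsCritical p c) :
    Cardinal.mk ((optimalMechanism h).outcome '' regionB c) = Cardinal.continuum := by
  have hmem : ∀ x ∈ Ico 0 c, ((1 : ℝ), x) ∈ regionB c := fun x hx =>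
    ⟨hx, by simp only; linarith [bdry_le_half hx.1 (by linarith [hx.2, h.hi])], le_rfl⟩
  refine (mk_le_continuum _).antisymm (continuum_le_of_injOn h.c_pos
    (f := fun x => (optimalMechanism h).outcome (1, x)) (fun x hx y hy hxy => ?_)
    fun x hx => mem_image_of_mem _ (hmem x hx))
  have := congrArg (fun o => o.1.2) hxy
  simp only [Mechanism.outcome, (outcome_of_mem_regionB h (hmem x hx)).1,
    (outcome_of_mem_regionB h (hmem y hy)).1] at this
  exact slope_injOn (by simp only [mem_Iic]; linarith [hx.2, h.hi])
    (by simp only [mem_Iic]; linarith [hy.2, h.hi]) this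

lemma mk_menu (h : IsCritical p c) :
    Cardinal.mk (optimalMechanism h).menu = Cardinal.continuum :=
  (mk_le_continuum _).antisymm ((mk_outcome_regionA h).ge.trans
    (Cardinal.mk_le_mk_of_subset (image_mono (regionA_subset h))))

end

end TwoItem

theorem mainTheorem10 :
    ∃ (p c : ℝ) (M : TwoItem.Mechanism),
      -- the critical price `p`: the only positive one for which `below p` has transformed mass zero
      (0 < p ∧ TwoItem.transformedMeasure TwoItem.jointDensity (TwoItem.below p) = 0 ∧
        (∀ q : ℝ, 0 < q →
          TwoItem.transformedMeasure TwoItem.jointDensity (TwoItem.below q) = 0 → q = p) ∧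
        |p - 0.5535| < 0.00005) ∧
      -- the critical point `(c, c)`: where the line `x + y = p` meets the two curves
      (IsLeast {x : ℝ | (x, p - x) ∈ TwoItem.below p} c ∧
        IsLeast {y : ℝ | (p - y, y) ∈ TwoItem.below p} c ∧
        TwoItem.bdry c = p - c ∧ 0.0618 < c ∧ c < 0.0619) ∧
      -- `Z` is the part of the square below the two curves and the line, without its upper boundary
      closure (TwoItem.regionZ p c) = TwoItem.below p ∧
      -- the four regions partition the type space
      (TwoItem.regionA c ⊆ TwoItem.typeSpace ∧ TwoItem.regionB c ⊆ TwoItem.typeSpace ∧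
        TwoItem.regionW p c ⊆ TwoItem.typeSpace ∧
        Disjoint (TwoItem.regionA c) (TwoItem.regionB c) ∧
        Disjoint (TwoItem.regionA c) (TwoItem.regionW p c) ∧
        Disjoint (TwoItem.regionB c) (TwoItem.regionW p c)) ∧
      -- `M` is an optimal IC and IR mechanism
      M.IsOptimal TwoItem.jointDensity ∧
      -- the outcomes of `M`
      (∀ v ∈ TwoItem.regionZ p c, M.alloc v = (0, 0) ∧ M.price v = 0) ∧
      (∀ x ∈ Set.Ico 0 c, HasDerivAt TwoItem.bdry (-(2 / (4 - 5 * x) ^ 2)) x) ∧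
      (∀ x y : ℝ, (x, y) ∈ TwoItem.regionA c →
        M.alloc (x, y) = (2 / (4 - 5 * x) ^ 2, 1) ∧
        M.price (x, y) = (2 - 3 * x) / (4 - 5 * x) + 2 * x / (4 - 5 * x) ^ 2) ∧
      (∀ x y : ℝ, (x, y) ∈ TwoItem.regionB c →
        M.alloc (x, y) = (1, 2 / (4 - 5 * y) ^ 2) ∧
        M.price (x, y) = (2 - 3 * y) / (4 - 5 * y) + 2 * y / (4 - 5 * y) ^ 2) ∧
      (∀ v ∈ TwoItem.regionW p c, M.alloc v = (1, 1) ∧ M.price v = p) ∧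
      -- a continuum of menu entries is offered, already in `𝒜` and in `ℬ`
      Cardinal.mk (M.outcome '' TwoItem.regionA c) = Cardinal.continuum ∧
      Cardinal.mk (M.outcome '' TwoItem.regionB c) = Cardinal.continuum ∧
      Cardinal.mk M.menu = Cardinal.continuum := by
  obtain ⟨p, c, h⟩ := TwoItem.exists_isCritical
  have h1 := h.lo
  have h2 := h.hi
  have h3 := h.lt_sub
  have h4 := h.sub_lt
  refine ⟨p, c, TwoItem.optimalMechanism h, ⟨by linarith, h.transformedMeasure_eq_zero,
    fun q hq hq0 => h.eq_of_transformedMeasure_eq_zero hq hq0, ?_⟩,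
    ⟨TwoItem.isLeast_fst h, TwoItem.isLeast_snd h, h.bdry_c, by linarith, by linarith⟩,
    TwoItem.closure_regionZ h,
    ⟨TwoItem.regionA_subset h, TwoItem.regionB_subset h, TwoItem.regionW_subset h,
      TwoItem.disjoint_regionA_regionB h, TwoItem.disjoint_regionA_regionW,
      TwoItem.disjoint_regionB_regionW⟩,
    TwoItem.optimalMechanism_isOptimal h, fun v hv => TwoItem.outcome_of_mem_regionZ h hv,
    fun x hx => TwoItem.hasDerivAt_bdry (by linarith [hx.2]),
    fun x y hv => TwoItem.outcome_of_mem_regionA h hv,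
    fun x y hv => TwoItem.outcome_of_mem_regionB h hv,
    fun v hv => TwoItem.outcome_of_mem_regionW h hv,
    TwoItem.mk_outcome_regionA h, TwoItem.mk_outcome_regionB h, TwoItem.mk_menu h⟩
  rw [abs_lt]
  constructor <;> linarith
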